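/- **Notation.** For $n\ge 2$ let $\mathrm{Diff}_{\mathbb R}^{[1,n]}$ be the group of orientation preserving $C^\infty$ diffeomorphisms of $\mathbb R$ that have compact support (equal the identity outside a compact set) and satisfy $h([1,n])=[1,n]$, and let $\mathrm{Diff}_{\mathbb R}^{f,e}$ be its subgroup of those $h$ with $h(k)=k$ for $k=1,\dots,n$. For $n\ge1$ let $S^1=\mathbb R/n\mathbb Z$, let $\mathrm{Diff}^+(S^1)$ be the group of orientation preserving $C^\infty$ diffeomorphisms of $S^1$, and $\mathrm{Diff}_{S^1}^{f,e}$ its subgroup of those that fix each of the points $1,\dots,n$ (mod $n$). For $r\in\{0,1,\dots,\infty\}$ the groups carry the strong $C^r$ Whitney topology: for finite $r$ a base of neighbourhoods of $g$ consists of the sets $\{h:\sum_{i=0}^r|g^{(i)}(z)-h^{(i)}(z)|<\varepsilon(z)\ \forall z\}$ with $\varepsilon>0$ continuous (on $S^1$ values and derivatives are taken through lifts to $\mathbb R$), and the $C^\infty$ topology is generated by all the $C^r$ topologies with $r<\infty$. The sets of left cosets carry the quotient topology. For $m\ge0$ and $0=x_0<x_1<\dots<x_m<x_{m+1}=m+1$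 put $$\mu_m(x_1,\dots,x_m,t)=\int_0^t\Bigl(1+\sum_{k=0}^m\bigl(e^{c_k\alpha_k(u)}-1\bigr)\Bigr)du ,$$ where $\alpha_k(u)=e^{-1/((u-k)(k+1-u))}$ for $u\in(k,k+1)$, $\alpha_k(u)=0$ otherwise, and $c_k\in\mathbb R$ is the unique number with $\int_k^{k+1}(e^{c_k\alpha_k(u)}-1)\,du=x_{k+1}-x_k-1$. **Theorem.** (1) Let $n\ge2$ and $\Delta_{n-2}=\{(x_2,\dots,x_{n-1})\in\mathbb R^{n-2}: 1<x_2<\dots<x_{n-1}<n\}$. The evaluation map $h\mapsto(h(2),\dots,h(n-1))$ induces a map $\mathrm{Diff}_{\mathbb R}^{[1,n]}/\mathrm{Diff}_{\mathbb R}^{f,e}\to\Delta_{n-2}$ which is a homeomorphism in the strong $C^r$ topology for every $r\in\{0,1,\dots,\infty\}$. The formula $\sigma(x_2,\dots,x_{n-1})(t)=\mu_n(1,x_2,\dots,x_{n-1},n,t)$ defines a section $\sigma:\Delta_{n-2}\to\mathrm{Diff}_{\mathbb R}^{[1,n]}$ of the evaluation map which is continuous in every strong $C^r$ topology. Consequently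 $\mathrm{Diff}_{\mathbb R}^{[1,n]}/\mathrm{Diff}_{\mathbb R}^{f,e}$ is homeomorphic to $\mathbb R^{n-2}$ in every strong $C^r$ topology. (2) Let $n\ge1$, let $F_n(S^1)=\{x\in(S^1)^n: x_i\ne x_j\text{ for }i\neq j\}$, and let $F_n^0$ be the connected component of $F_n(S^1)$ containing $(1,\dots,n)$. The evaluation map $h\mapsto(h(1),\dots,h(n))$ induces a map $\mathrm{Diff}^+(S^1)/\mathrm{Diff}_{S^1}^{f,e}\to F_n^0$ which is a homeomorphism in the strong $C^r$ topology for every $r\in\{0,1,\dots,\infty\}$. With $\Delta_{n-1}=\{(x_1,\dots,x_{n-1})\in\mathbb R^{n-1}:0<x_1<\dots<x_{n-1}<n\}$, the map $\Theta:\Delta_{n-1}\times S^1\to F_n^0$, $\Theta(x,\theta)=(x_1+\theta,\dots,x_{n-1}+\theta,\theta)$, is a homeomorphism, and the formula $$\sigma(\Theta(x,\theta))(t\bmod n)=\mu_{n-1}(x,t)+\theta \bmod n,\qquad t\in[0,n],$$ defines a section $\sigma:F_n^0\to\mathrm{Diff}^+(S^1)$ of the evaluation map which is continuous in every strong $C^r$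 topology. Consequently $\mathrm{Diff}^+(S^1)/\mathrm{Diff}_{S^1}^{f,e}$ is homeomorphic to $S^1\times\mathbb R^{n-1}$ in every strong $C^r$ topology. -/

import Mathlib

open Set Topology
open scoped ContDiff

namespace WhitneyDiff

noncomputable section

/-! ### Diffeomorphisms of the real line -/

/-- The group of `C^∞` diffeomorphisms of `ℝ`, under composition. -/
def diffR : Subgroup (Equiv.Perm ℝ) where
  carrier := {h | ContDiff ℝ ∞ (h : ℝ → ℝ) ∧ ContDiff ℝ ∞ (h.symm : ℝ → ℝ)}
  one_mem' := ⟨contDiff_id, contDiff_id⟩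
  mul_mem' := by
    rintro a b ⟨ha, ha'⟩ ⟨hb, hb'⟩
    exact ⟨ha.comp hb, hb'.comp ha'⟩
  inv_mem' := by
    rintro a ⟨ha, ha'⟩
    exact ⟨ha', ha⟩

/-- The orientation preserving diffeomorphisms of `ℝ` with compact support (that is, equal to the
identity outside a compact set) which leave the interval `[1, n]` invariant. -/
def diffRf (n : ℕ) : Subgroup diffR where
  carrier := {h | StrictMono (h.1 : ℝ → ℝ) ∧
    (∃ K : Set ℝ, IsCompact K ∧ ∀ t, t ∉ K → h.1 t = t) ∧
    (h.1 : ℝ → ℝ) '' Icc 1 (n : ℝ) = Icc 1 (n : ℝ)}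
  one_mem' := by
    refine ⟨strictMono_id, ⟨∅, isCompact_empty, fun t _ => rfl⟩, ?_⟩
    exact image_id _
  mul_mem' := by
    rintro a b ⟨ha, ⟨K, hK, haK⟩, ha1⟩ ⟨hb, ⟨L, hL, hbL⟩, hb1⟩
    refine ⟨ha.comp hb, ⟨K ∪ L, hK.union hL, fun t ht => ?_⟩, ?_⟩
    · rw [mem_union, not_or] at ht
      change a.1 (b.1 t) = t
      rw [hbL t ht.2, haK t ht.1]
    · change (a.1 ∘ b.1) '' _ = _
      rw [image_comp, hb1, ha1]
  inv_mem' := by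
    rintro a ⟨ha, ⟨K, hK, haK⟩, ha1⟩
    refine ⟨fun s t hst => ?_, ⟨K, hK, fun t ht => ?_⟩, ?_⟩
    · change a.1.symm s < a.1.symm t
      rw [← ha.lt_iff_lt]
      simpa using hst
    · change a.1.symm t = t
      rw [Equiv.symm_apply_eq, haK t ht]
    · change a.1.symm '' _ = _
      conv_lhs => rw [← ha1]
      rw [← image_comp, Equiv.symm_comp_self, image_id]

/-- The elements of `diffRf n` which fix each of the points `1, …, n`. -/
def diffRfe (n : ℕ) : Subgroup (diffRf n) where
  carrier := {h | ∀ k : ℕ, 1 ≤ k → k ≤ n → h.1.1 (k : ℝ) = k}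
  one_mem' := fun _ _ _ => rfl
  mul_mem' := by
    intro a b ha hb k h1 h2
    change a.1.1 (b.1.1 k) = k
    rw [hb k h1 h2, ha k h1 h2]
  inv_mem' := by
    intro a ha k h1 h2
    change a.1.1.symm k = k
    rw [Equiv.symm_apply_eq, ha k h1 h2]

/-- The basic `C^k` neighbourhood of `g` of (variable) radius `ε`. -/
def ballR (k : ℕ) (g : diffR) (ε : ℝ → ℝ) : Set diffR :=
  {h | ∀ z : ℝ, ∑ i ∈ Finset.range (k + 1),
    |iteratedDeriv i (g.1 : ℝ → ℝ) z - iteratedDeriv i (h.1 : ℝ → ℝ) z| < ε z}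

/-- The strong `C^r` Whitney topology on the diffeomorphisms of `ℝ`, `r = 0, 1, …, ∞`; the strong
`C^∞` topology is generated by the strong `C^k` topologies with `k` finite. -/
abbrev whitneyR (r : ℕ∞) : TopologicalSpace diffR :=
  TopologicalSpace.generateFrom
    {U | ∃ (k : ℕ) (g : diffR) (ε : ℝ → ℝ), (k : ℕ∞) ≤ r ∧ Continuous ε ∧ (∀ z, 0 < ε z) ∧
      U = ballR k g ε}

/-- The subspace topology on `diffRf n`. -/
abbrev whitneyRf (n : ℕ) (r : ℕ∞) : TopologicalSpace (diffRf n) :=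
  (whitneyR r).induced Subtype.val

/-- The quotient topology on the space of left cosets `h · diffRfe n`, `h ∈ diffRf n`. -/
abbrev whitneyRQuot (n : ℕ) (r : ℕ∞) : TopologicalSpace (diffRf n ⧸ diffRfe n) :=
  (whitneyRf n r).coinduced QuotientGroup.mk

/-- The evaluation map `h ↦ (h(2), …, h(n-1))`. -/
def evalR (n : ℕ) (h : diffRf n) : Fin (n - 2) → ℝ := fun i => h.1.1 ((i : ℝ) + 2)

/-! ### Diffeomorphisms of the circle `ℝ / nℤ` -/

/-- `F : ℝ → ℝ` is a lift of the self-map `f` of the circle `ℝ / nℤ`. -/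
def IsLift (n : ℕ) (f : AddCircle (n : ℝ) → AddCircle (n : ℝ)) (F : ℝ → ℝ) : Prop :=
  ∀ t : ℝ, f (t : AddCircle (n : ℝ)) = (F t : AddCircle (n : ℝ))

/-- The group of orientation preserving `C^∞` diffeomorphisms of the circle `ℝ / nℤ`: the bijections
which, together with their inverses, are given by smooth increasing lifts to the universal cover. -/
def diffS (n : ℕ) : Subgroup (Equiv.Perm (AddCircle (n : ℝ))) where
  carrier := {h | (∃ F : ℝ → ℝ, ContDiff ℝ ∞ F ∧ StrictMono F ∧ IsLift n h F) ∧
    ∃ F : ℝ → ℝ, ContDiff ℝ ∞ F ∧ StrictMono F ∧ IsLift n h.symm F}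
  one_mem' := ⟨⟨id, contDiff_id, strictMono_id, fun _ => rfl⟩,
    ⟨id, contDiff_id, strictMono_id, fun _ => rfl⟩⟩
  mul_mem' := by
    rintro a b ⟨⟨A, hA, mA, lA⟩, ⟨A', hA', mA', lA'⟩⟩ ⟨⟨B, hB, mB, lB⟩, ⟨B', hB', mB', lB'⟩⟩
    refine ⟨⟨A ∘ B, hA.comp hB, mA.comp mB, fun t => ?_⟩,
      ⟨B' ∘ A', hB'.comp hA', mB'.comp mA', fun t => ?_⟩⟩
    · change a (b t) = _
      rw [lB t, lA]
      rfl
    · change b.symm (a.symm t) = _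
      rw [lA' t, lB']
      rfl
  inv_mem' := by
    rintro a ⟨h1, h2⟩
    exact ⟨h2, h1⟩

/-- The elements of `diffS n` which fix each of the points `1, …, n` of `ℝ / nℤ`. -/
def diffSfe (n : ℕ) : Subgroup (diffS n) where
  carrier := {h | ∀ k : ℕ, 1 ≤ k → k ≤ n →
    h.1 ((k : ℝ) : AddCircle (n : ℝ)) = ((k : ℝ) : AddCircle (n : ℝ))}
  one_mem' := fun _ _ _ => rfl
  mul_mem' := by
    intro a b ha hb k h1 h2
    change a.1 (b.1 _) = _
    rw [hb k h1 h2, ha k h1 h2]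
  inv_mem' := by
    intro a ha k h1 h2
    change a.1.symm _ = _
    rw [Equiv.symm_apply_eq, ha k h1 h2]

/-- The basic `C^k` neighbourhood of `g` of (variable) radius `ε`: the derivatives of circle maps
are those of their lifts, and two circle maps are at distance less than `ε` when they have
lifts which are. -/
def ballS (n k : ℕ) (g : diffS n) (ε : AddCircle (n : ℝ) → ℝ) : Set (diffS n) :=
  {h | ∃ G H : ℝ → ℝ, ContDiff ℝ ∞ G ∧ IsLift n g.1 G ∧ ContDiff ℝ ∞ H ∧ IsLift n h.1 H ∧
    ∀ t : ℝ, ∑ i ∈ Finset.range (k + 1), |iteratedDeriv i G t - iteratedDeriv i H t|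
      < ε (t : AddCircle (n : ℝ))}

/-- The strong `C^r` Whitney topology on `diffS n`, `r = 0, 1, …, ∞`. -/
abbrev whitneyS (n : ℕ) (r : ℕ∞) : TopologicalSpace (diffS n) :=
  TopologicalSpace.generateFrom
    {U | ∃ (k : ℕ) (g : diffS n) (ε : AddCircle (n : ℝ) → ℝ),
      (k : ℕ∞) ≤ r ∧ Continuous ε ∧ (∀ z, 0 < ε z) ∧ U = ballS n k g ε}

/-- The quotient topology on the space of left cosets `h · diffSfe n`, `h ∈ diffS n`. -/
abbrev whitneySQuot (n : ℕ) (r : ℕ∞) : TopologicalSpace (diffS n ⧸ diffSfe n) :=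
  (whitneyS n r).coinduced QuotientGroup.mk

/-- The evaluation map `h ↦ (h(1), …, h(n))`. -/
def evalS (n : ℕ) (h : diffS n) : Fin n → AddCircle (n : ℝ) :=
  fun i => h.1 (((i : ℝ) + 1 : ℝ) : AddCircle (n : ℝ))

/-- The `n`-th configuration space of the circle `ℝ / nℤ`. -/
def confS (n : ℕ) : Set (Fin n → AddCircle (n : ℝ)) := {x | Function.Injective x}

/-- The connected component of the configuration space which contains `(1, …, n)`. -/
def confS₀ (n : ℕ) : Set (Fin n → AddCircle (n : ℝ)) :=
  connectedComponentIn (confS n) (fun i => (((i : ℝ) + 1 : ℝ) : AddCircle (n : ℝ)))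

/-! ### Simplices and the explicit section -/

/-- The open simplex `{(x₁, …, x_m) | a < x₁ < ⋯ < x_m < b}`. -/
def simplex (m : ℕ) (a b : ℝ) : Set (Fin m → ℝ) :=
  {x | StrictMono x ∧ ∀ i, a < x i ∧ x i < b}

/-- The point `(x₁ + θ, …, x_{n-1} + θ, θ)` of the torus. -/
def rotate (n : ℕ) (x : Fin (n - 1) → ℝ) (θ : AddCircle (n : ℝ)) :
    Fin n → AddCircle (n : ℝ) :=
  fun i => if hi : (i : ℕ) < n - 1 then (x ⟨i, hi⟩ : AddCircle (n : ℝ)) + θ else θ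

/-- For `n ≥ 2`, the point `(1, x₁, …, x_{n-2}, n)` of `ℝⁿ`. -/
def addEnds (n : ℕ) (x : Fin (n - 2) → ℝ) : Fin n → ℝ :=
  fun i => if (i : ℕ) = 0 then 1 else
    if hi : (i : ℕ) - 1 < n - 2 then x ⟨(i : ℕ) - 1, hi⟩ else n

/-- The bump function `e^{-1/((t-a)(b-t))} / (b-a)` on `(a, b)`, extended by zero. -/
def bump (a b t : ℝ) : ℝ := expNegInvGlue ((t - a) * (b - t)) / (b - a)

/-- The function `γ(c) = ∫_a^b (e^{c α(t)} - 1) dt`, where `α` is the bump function of `(a, b)`; it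
is an increasing bijection of `ℝ` onto `(-(b-a), ∞)` when `a < b`. -/
def gam (a b c : ℝ) : ℝ := ∫ t in a..b, (Real.exp (c * bump a b t) - 1)

/-- The function `t ↦ e^{γ⁻¹(s-(b-a)) α(t)} - 1`, which vanishes outside `(a, b)` and has integral
`s - (b - a)` if `s > 0`. -/
def correction (a b s t : ℝ) : ℝ :=
  Real.exp (Function.invFun (gam a b) (s - (b - a)) * bump a b t) - 1

/-- The nodes `x₀ = 0, x₁, …, x_m, x_{m+1} = m + 1`. -/
def node (m : ℕ) (x : Fin m → ℝ) : ℕ → ℝ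
  | 0 => 0
  | k + 1 => if hk : k < m then x ⟨k, hk⟩ else (m : ℝ) + 1

/-- The function `μ(x₁, …, x_m, t)`, which for `0 < x₁ < ⋯ < x_m < m + 1` is a diffeomorphism of the
line in the variable `t`, the identity outside `[0, m + 1]`, and takes `k` to `x_k`. -/
def stretch (m : ℕ) (x : Fin m → ℝ) (t : ℝ) : ℝ :=
  ∫ u in (0 : ℝ)..t, (1 + ∑ k ∈ Finset.range (m + 1),
    correction (k : ℝ) ((k : ℝ) + 1) (node m x (k + 1) - node m x k) u)

end

end WhitneyDiff

/-!
For both groups the evaluation map is constant exactly on the left cosets of the stabiliser of the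
nodes, so it induces an injection of the coset space (`exists_isHomeomorph_quotient`). This
injection is continuous because evaluation at a point is already continuous for the strong `C^0`
topology, and its inverse is the composition of a continuous section of the evaluation map with the
projection to the cosets. So everything rests on the section given by the stretching maps.

The density of `μ` is `1 + ∑ₖ (e^{cₖ αₖ} - 1)`. It is positive, since at each point at most one
summand is nonzero, and it is `1` outside `[0, m + 1]`. Its integral over `[k, k + 1]` is
`x_{k+1} - x_k` by the choice of `cₖ`. The constant `cₖ` exists and depends continuously on the
nodes because `γ` is continuous and strictly increasing with range `(-(b - a), ∞)`. As the density
is smooth in all `cₖ` and `t` together, all derivatives of `μ` in `t` are jointly continuous in the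
nodes and in `t` (`continuousOn_iteratedDeriv_stretch`).

Joint continuity gives continuity for the strong topologies by a compactness argument: on the line
the maps are the identity outside a fixed compact interval (`continuous_whitneyR_of_support`), and
on the circle it suffices to look at one closed period (`continuous_whitneyS_of_lift`). On the
circle the map `μ` is first extended from `[0, n]` to the line so that it commutes with the
translation by `n` (`wrap`), and the angle is replaced by a real number, which is allowed as
`ℝ → ℝ / nℤ` is an open quotient map.

The component `confS₀ n` consists of the configurations in the cyclic order of `(1, …, n)`
(`confS₀_eq`). A lift of an orientation preserving diffeomorphism has degree one
(`IsLift.strictMono_add_period`), whence evaluation takes values in this component. Finally, the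
open simplices are bounded, convex, open and nonempty, hence homeomorphic to Euclidean spaces.
-/

namespace WhitneyDiff

/-! ### The bump functions and the normalising constants -/

theorem bump_contDiff (a b : ℝ) : ContDiff ℝ ∞ (bump a b) := by
  unfold bump
  exact (expNegInvGlue.contDiff.comp (by fun_prop)).div_const _

theorem bump_pos {a b t : ℝ} (ht : t ∈ Ioo a b) : 0 < bump a b t :=
  div_pos (expNegInvGlue.pos_of_pos (mul_pos (sub_pos.2 ht.1) (sub_pos.2 ht.2)))
    (sub_pos.2 (ht.1.trans ht.2))

theorem bump_eq_zero {a b t : ℝ} (hab : a < b) (ht : t ∉ Ioo a b) : bump a b t = 0 := by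
  have : (t - a) * (b - t) ≤ 0 := by
    rcases le_or_gt t a with h | h
    · exact mul_nonpos_of_nonpos_of_nonneg (by linarith) (by linarith)
    · have : b ≤ t := not_lt.1 fun h' => ht ⟨h, h'⟩
      exact mul_nonpos_of_nonneg_of_nonpos (by linarith) (by linarith)
  rw [bump, expNegInvGlue.zero_of_nonpos this, zero_div]

theorem bump_nonneg {a b : ℝ} (hab : a < b) (t : ℝ) : 0 ≤ bump a b t :=
  div_nonneg (expNegInvGlue.nonneg _) (sub_pos.2 hab).le

theorem continuous_gam (a b : ℝ) : Continuous (gam a b) := by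
  have := (bump_contDiff a b).continuous
  unfold gam
  exact intervalIntegral.continuous_parametric_intervalIntegral_of_continuous'
    (f := fun c t => Real.exp (c * bump a b t) - 1) (by unfold Function.uncurry; fun_prop) a b

theorem gam_strictMono {a b : ℝ} (hab : a < b) : StrictMono (gam a b) := by
  intro c d hcd
  have := (bump_contDiff a b).continuous
  refine intervalIntegral.integral_lt_integral_of_continuousOn_of_le_of_exists_lt hab
    (by fun_prop) (by fun_prop) (fun t _ => ?_) ⟨(a + b) / 2, ⟨by linarith, by linarith⟩, ?_⟩
  · have := bump_nonneg hab t
    gcongr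
  · have : 0 < bump a b ((a + b) / 2) := bump_pos ⟨by linarith, by linarith⟩
    gcongr

/-- As `c → -∞`, the function `e^{cα}` tends to zero boundedly on the support of `α`. -/
theorem tendsto_gam_atBot {a b : ℝ} (hab : a < b) :
    Filter.Tendsto (gam a b) Filter.atBot (𝓝 (-(b - a))) := by
  have hc := (bump_contDiff a b).continuous
  have : -(b - a) = ∫ _ in a..b, (-1 : ℝ) := by simp
  rw [this]
  refine intervalIntegral.tendsto_integral_filter_of_dominated_convergence (fun _ => 1) ?_ ?_
    (by simp) ?_
  · exact Filter.Eventually.of_forall fun c =>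
      Continuous.aestronglyMeasurable (by fun_prop)
  · filter_upwards [Filter.eventually_le_atBot 0] with c hc0
    refine Filter.Eventually.of_forall fun t _ => ?_
    have h1 : Real.exp (c * bump a b t) ≤ 1 :=
      Real.exp_le_one_iff.2 (mul_nonpos_of_nonpos_of_nonneg hc0 (bump_nonneg hab t))
    rw [Real.norm_eq_abs, abs_le]
    constructor <;> linarith [Real.exp_pos (c * bump a b t)]
  · have hb : ∀ᵐ t : ℝ, t ≠ b := by simp [MeasureTheory.ae_iff]
    filter_upwards [hb] with t htb ht
    rw [uIoc_of_le hab.le] at ht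
    have hpos : 0 < bump a b t := bump_pos ⟨ht.1, lt_of_le_of_ne ht.2 htb⟩
    have h0 : Filter.Tendsto (fun c => Real.exp (c * bump a b t)) Filter.atBot (𝓝 0) :=
      Real.tendsto_exp_atBot.comp (Filter.tendsto_id.atBot_mul_const hpos)
    simpa using h0.sub_const 1

theorem tendsto_gam_atTop {a b : ℝ} (hab : a < b) :
    Filter.Tendsto (gam a b) Filter.atTop Filter.atTop := by
  have hc := (bump_contDiff a b).continuous
  have hI : 0 < ∫ t in a..b, bump a b t :=
    intervalIntegral.intervalIntegral_pos_of_pos_on (hc.intervalIntegrable _ _)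
      (fun t ht => bump_pos ht) hab
  refine Filter.tendsto_atTop_mono (fun c => ?_) (Filter.tendsto_id.atTop_mul_const hI)
  rw [id, ← intervalIntegral.integral_const_mul]
  refine intervalIntegral.integral_mono_on hab.le
    (Continuous.intervalIntegrable (by fun_prop) _ _)
    (Continuous.intervalIntegrable (by fun_prop) _ _) fun t _ => ?_
  linarith [Real.add_one_le_exp (c * bump a b t)]

theorem exists_gam_eq {a b s : ℝ} (hab : a < b) (hs : 0 < s) : ∃ c, gam a b c = s - (b - a) := by
  obtain ⟨c, hc⟩ := ((tendsto_gam_atBot hab).eventually_lt_const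
    (show -(b - a) < s - (b - a) by linarith)).exists
  obtain ⟨d, hd⟩ := ((tendsto_gam_atTop hab).eventually_ge_atTop (s - (b - a))).exists
  exact mem_range_of_exists_le_of_exists_ge (continuous_gam a b) ⟨c, hc.le⟩ ⟨d, hd⟩

/-- The constant `c` for which `e^{cα}` has integral `s` over `[a, b]`, where `α` is the bump
function of `(a, b)`; it is meaningful for `s > 0`. -/
noncomputable def coef (a b s : ℝ) : ℝ := Function.invFun (gam a b) (s - (b - a))

theorem gam_coef {a b s : ℝ} (hab : a < b) (hs : 0 < s) :
    gam a b (coef a b s) = s - (b - a) :=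
  Function.invFun_eq (exists_gam_eq hab hs)

theorem continuousOn_coef {a b : ℝ} (hab : a < b) : ContinuousOn (coef a b) (Ioi 0) := by
  have hmono : StrictMonoOn (coef a b) (Ioi 0) := fun s hs t ht hst => by
    rw [← (gam_strictMono hab).lt_iff_lt, gam_coef hab hs, gam_coef hab ht]
    linarith
  have himage : coef a b '' Ioi 0 = univ := by
    refine eq_univ_of_forall fun c => ⟨gam a b c + (b - a), ?_, ?_⟩
    · have hc := (gam_strictMono hab).monotone.le_of_tendsto (tendsto_gam_atBot hab) (c - 1)
      have := gam_strictMono hab (sub_one_lt c)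
      rw [mem_Ioi]
      linarith
    · rw [coef, add_sub_cancel_right]
      exact Function.leftInverse_invFun (gam_strictMono hab).injective c
  intro s hs
  refine (hmono.continuousAt_of_image_mem_nhds (Ioi_mem_nhds hs) ?_).continuousWithinAt
  rw [himage]
  exact Filter.univ_mem

/-! ### The density of the stretching maps -/

/-- The function `1 + ∑ₖ (e^{cₖ αₖ} - 1)`, as a function of arbitrary constants `cₖ`. -/
noncomputable def density (m : ℕ) (c : Fin (m + 1) → ℝ) (t : ℝ) : ℝ :=
  1 + ∑ k : Fin (m + 1), (Real.exp (c k * bump (k : ℕ) ((k : ℕ) + 1) t) - 1)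

/-- The constants `cₖ` determined by the nodes. -/
noncomputable def coefs (m : ℕ) (x : Fin m → ℝ) (k : Fin (m + 1)) : ℝ :=
  coef (k : ℕ) ((k : ℕ) + 1) (node m x (k + 1) - node m x k)

theorem stretch_eq (m : ℕ) (x : Fin m → ℝ) (t : ℝ) :
    stretch m x t = ∫ u in (0 : ℝ)..t, density m (coefs m x) u := by
  unfold stretch density
  simp_rw [Finset.sum_range]
  rfl

theorem density_contDiff (m : ℕ) :
    ContDiff ℝ ∞ (Function.uncurry (density m)) := by
  unfold density Function.uncurry
  refine contDiff_const.add (ContDiff.sum fun k _ => ContDiff.sub ?_ contDiff_const)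
  refine Real.contDiff_exp.comp (ContDiff.mul ?_ ((bump_contDiff _ _).comp contDiff_snd))
  exact (contDiff_apply ℝ ℝ k).comp contDiff_fst

theorem continuous_density (m : ℕ) (c : Fin (m + 1) → ℝ) : Continuous (density m c) :=
  (density_contDiff m).continuous.comp (Continuous.prodMk_right c)

/-- The bump functions have disjoint supports, so on each unit interval only one term of the
density contributes. -/
theorem density_eq_exp {m : ℕ} (c : Fin (m + 1) → ℝ) (k : Fin (m + 1)) {t : ℝ}
    (ht : t ∈ Icc ((k : ℕ) : ℝ) ((k : ℕ) + 1)) :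
    density m c t = Real.exp (c k * bump (k : ℕ) ((k : ℕ) + 1) t) := by
  rw [density, Finset.sum_eq_single k]
  · ring
  · intro j _ hj
    rw [bump_eq_zero (by linarith), mul_zero, Real.exp_zero, sub_self]
    rintro ⟨h1, h2⟩
    have h3 : ((j : ℕ) : ℝ) < (k : ℕ) + 1 := h1.trans_le ht.2
    have h4 : ((k : ℕ) : ℝ) < (j : ℕ) + 1 := ht.1.trans_lt h2
    norm_cast at h3 h4
    exact hj (Fin.ext (by omega))
  · simp

theorem density_eq_one {m : ℕ} (c : Fin (m + 1) → ℝ) {t : ℝ}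
    (ht : t ∉ Ioo 0 ((m : ℝ) + 1)) : density m c t = 1 := by
  rw [density, Finset.sum_eq_zero, add_zero]
  intro j _
  rw [bump_eq_zero (by linarith), mul_zero, Real.exp_zero, sub_self]
  rintro ⟨h1, h2⟩
  refine ht ⟨(Nat.cast_nonneg _).trans_lt h1, h2.trans_le ?_⟩
  have : (j : ℕ) + 1 ≤ m + 1 := j.2
  exact_mod_cast this

theorem density_pos {m : ℕ} (c : Fin (m + 1) → ℝ) (t : ℝ) : 0 < density m c t := by
  by_cases ht : t ∈ Ioo 0 ((m : ℝ) + 1)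
  · have hf : ⌊t⌋₊ < m + 1 := (Nat.floor_lt ht.1.le).2 (by exact_mod_cast ht.2)
    rw [density_eq_exp c ⟨⌊t⌋₊, hf⟩ ⟨Nat.floor_le ht.1.le, (Nat.lt_floor_add_one t).le⟩]
    exact Real.exp_pos _
  · rw [density_eq_one c ht]
    exact one_pos

/-! ### Primitives of the density and the stretching maps -/

theorem contDiff_iteratedDeriv_param {E : Type*} [NormedAddCommGroup E] [NormedSpace ℝ E]
    {f : E → ℝ → ℝ} (hf : ContDiff ℝ ∞ (Function.uncurry f)) (i : ℕ) :
    ContDiff ℝ ∞ (fun p : E × ℝ => iteratedDeriv i (f p.1) p.2) := by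
  induction i with
  | zero =>
    simp only [iteratedDeriv_zero]
    exact hf
  | succ i ih =>
    have h : ∀ p : E × ℝ, iteratedDeriv (i + 1) (f p.1) p.2 =
        fderiv ℝ (fun p : E × ℝ => iteratedDeriv i (f p.1) p.2) p (0, 1) := by
      rintro ⟨c, t⟩
      rw [iteratedDeriv_succ]
      have h1 := (ih.differentiable (by simp) (c, t)).hasFDerivAt
      have h2 : HasDerivAt (fun t : ℝ => (c, t)) ((0, 1) : E × ℝ) t :=
        (hasDerivAt_const t c).prodMk (hasDerivAt_id t)
      exact (h1.comp_hasDerivAt t h2).deriv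
    simp_rw [h]
    exact (ih.fderiv_right (m := ∞) (by simp)).clm_apply contDiff_const

/-- The primitive of the density which vanishes at `0`, as a function of the constants `cₖ`. -/
noncomputable def primitive (m : ℕ) (c : Fin (m + 1) → ℝ) (t : ℝ) : ℝ :=
  ∫ u in (0 : ℝ)..t, density m c u

theorem hasDerivAt_primitive (m : ℕ) (c : Fin (m + 1) → ℝ) (t : ℝ) :
    HasDerivAt (primitive m c) (density m c t) t :=
  (continuous_density m c).integral_hasStrictDerivAt 0 t |>.hasDerivAt

theorem deriv_primitive (m : ℕ) (c : Fin (m + 1) → ℝ) :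
    deriv (primitive m c) = density m c :=
  funext fun t => (hasDerivAt_primitive m c t).deriv

theorem primitive_contDiff (m : ℕ) (c : Fin (m + 1) → ℝ) : ContDiff ℝ ∞ (primitive m c) := by
  rw [contDiff_infty_iff_deriv, deriv_primitive]
  exact ⟨fun t => (hasDerivAt_primitive m c t).differentiableAt,
    (density_contDiff m).comp (contDiff_prodMk_right c)⟩

/-- All derivatives of the primitive depend jointly continuously on the constants and on the
variable. -/
theorem continuous_iteratedDeriv_primitive (m i : ℕ) :
    Continuous (fun p : (Fin (m + 1) → ℝ) × ℝ => iteratedDeriv i (primitive m p.1) p.2) := by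
  cases i with
  | zero =>
    simp only [iteratedDeriv_zero]
    exact intervalIntegral.continuous_parametric_primitive_of_continuous
      (density_contDiff m).continuous
  | succ i =>
    simp only [iteratedDeriv_succ', deriv_primitive]
    exact (contDiff_iteratedDeriv_param (density_contDiff m) i).continuous

theorem primitive_of_nonpos {m : ℕ} (c : Fin (m + 1) → ℝ) {t : ℝ} (ht : t ≤ 0) :
    primitive m c t = t := by
  have : ∫ u in (0 : ℝ)..t, density m c u = ∫ _ in (0 : ℝ)..t, (1 : ℝ) :=
    intervalIntegral.integral_congr fun u hu => density_eq_one c fun h => by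
      rw [uIcc_of_ge ht] at hu
      exact absurd h.1 (not_lt.2 hu.2)
  rw [primitive, this]
  simp

theorem stretch_eq_primitive (m : ℕ) (x : Fin m → ℝ) :
    stretch m x = primitive m (coefs m x) :=
  funext fun t => stretch_eq m x t

theorem node_succ_of_lt {m k : ℕ} (x : Fin m → ℝ) (h : k < m) :
    node m x (k + 1) = x ⟨k, h⟩ := by
  simp [node, h]

theorem node_last (m : ℕ) (x : Fin m → ℝ) : node m x (m + 1) = (m : ℝ) + 1 := by
  simp [node]

theorem node_lt {m : ℕ} {x : Fin m → ℝ} (hx : x ∈ simplex m 0 ((m : ℝ) + 1)) {k : ℕ}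
    (hk : k ≤ m) : node m x k < node m x (k + 1) := by
  rcases hk.lt_or_eq with h | rfl
  · cases k with
    | zero =>
      rw [node_succ_of_lt x h]
      exact (hx.2 _).1
    | succ k =>
      rw [node_succ_of_lt x h, node_succ_of_lt x (by omega)]
      exact hx.1 (by simp)
  · cases k with
    | zero =>
      rw [node_last]
      norm_num [node]
    | succ k =>
      rw [node_last, node_succ_of_lt x (by omega)]
      exact (hx.2 _).2

theorem continuous_node (m k : ℕ) : Continuous (fun x : Fin m → ℝ => node m x k) := by
  cases k with
  | zero => exact continuous_const
  | succ k =>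
    by_cases h : k < m
    · simp only [node, h, dif_pos]
      fun_prop
    · simp only [node, h, dif_neg, not_false_eq_true]
      fun_prop

theorem continuousOn_coefs (m : ℕ) : ContinuousOn (coefs m) (simplex m 0 ((m : ℝ) + 1)) := by
  refine continuousOn_pi.2 fun k => ?_
  refine (continuousOn_coef (lt_add_one _)).comp
    ((continuous_node m _).sub (continuous_node m _)).continuousOn fun x hx => ?_
  exact sub_pos.2 (node_lt hx (Nat.lt_succ_iff.1 k.2))

theorem integral_density {m : ℕ} {x : Fin m → ℝ} (hx : x ∈ simplex m 0 ((m : ℝ) + 1))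
    {k : ℕ} (hk : k ≤ m) :
    ∫ u in (k : ℝ)..((k : ℝ) + 1), density m (coefs m x) u = node m x (k + 1) - node m x k := by
  let j : Fin (m + 1) := ⟨k, Nat.lt_succ_iff.2 hk⟩
  have hk1 : (k : ℝ) < k + 1 := lt_add_one _
  have hc := (bump_contDiff (k : ℝ) (k + 1)).continuous
  have h1 : ∫ u in (k : ℝ)..((k : ℝ) + 1), density m (coefs m x) u =
      ∫ u in (k : ℝ)..((k : ℝ) + 1), ((Real.exp (coefs m x j * bump k (k + 1) u) - 1) + 1) :=
    intervalIntegral.integral_congr fun u hu => by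
      rw [uIcc_of_le hk1.le] at hu
      rw [density_eq_exp _ j hu]
      ring
  have h2 := gam_coef hk1 (sub_pos.2 (node_lt hx hk))
  rw [h1, intervalIntegral.integral_add (Continuous.intervalIntegrable (by fun_prop) _ _)
    (by simp)]
  change gam k (k + 1) (coef k (k + 1) (node m x (k + 1) - node m x k)) + _ = _
  rw [h2]
  simp

theorem stretch_natCast {m : ℕ} {x : Fin m → ℝ} (hx : x ∈ simplex m 0 ((m : ℝ) + 1))
    {k : ℕ} (hk : k ≤ m + 1) : stretch m x k = node m x k := by
  have hi (a b : ℝ) := (continuous_density m (coefs m x)).intervalIntegrable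
    (μ := MeasureTheory.volume) a b
  rw [stretch_eq]
  induction k with
  | zero => simp [node]
  | succ k ih =>
    rw [Nat.cast_succ, ← intervalIntegral.integral_add_adjacent_intervals (hi 0 k) (hi k _),
      ih (by omega), integral_density hx (by omega)]
    ring

theorem stretch_of_ge {m : ℕ} {x : Fin m → ℝ} (hx : x ∈ simplex m 0 ((m : ℝ) + 1))
    {t : ℝ} (ht : (m : ℝ) + 1 ≤ t) : stretch m x t = t := by
  have hi (a b : ℝ) := (continuous_density m (coefs m x)).intervalIntegrable
    (μ := MeasureTheory.volume) a b
  have h1 := stretch_natCast hx le_rfl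
  rw [node_last, stretch_eq] at h1
  push_cast at h1
  have h2 : ∫ u in ((m : ℝ) + 1)..t, density m (coefs m x) u =
      ∫ _ in ((m : ℝ) + 1)..t, (1 : ℝ) :=
    intervalIntegral.integral_congr fun u hu => density_eq_one _ fun h => by
      rw [uIcc_of_le ht] at hu
      exact absurd h.2 (not_lt.2 hu.1)
  rw [stretch_eq, ← intervalIntegral.integral_add_adjacent_intervals (hi 0 _) (hi (m + 1) _),
    h1, h2]
  simp

theorem stretch_of_le (m : ℕ) (x : Fin m → ℝ) {t : ℝ} (ht : t ≤ 0) : stretch m x t = t := by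
  rw [stretch_eq_primitive, primitive_of_nonpos _ ht]

theorem stretch_contDiff (m : ℕ) (x : Fin m → ℝ) : ContDiff ℝ ∞ (stretch m x) := by
  rw [stretch_eq_primitive]
  exact primitive_contDiff _ _

theorem deriv_stretch_pos (m : ℕ) (x : Fin m → ℝ) (t : ℝ) : 0 < deriv (stretch m x) t := by
  rw [stretch_eq_primitive, deriv_primitive]
  exact density_pos _ t

theorem stretch_strictMono (m : ℕ) (x : Fin m → ℝ) : StrictMono (stretch m x) :=
  strictMono_of_deriv_pos (deriv_stretch_pos m x)

/-- All derivatives of the stretching maps are jointly continuous in the nodes and the variable. -/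
theorem continuousOn_iteratedDeriv_stretch (m i : ℕ) :
    ContinuousOn (fun p : (Fin m → ℝ) × ℝ => iteratedDeriv i (stretch m p.1) p.2)
      (simplex m 0 ((m : ℝ) + 1) ×ˢ univ) := by
  have h : ContinuousOn (fun p : (Fin m → ℝ) × ℝ => (coefs m p.1, p.2))
      (simplex m 0 ((m : ℝ) + 1) ×ˢ univ) :=
    ((continuousOn_coefs m).comp continuousOn_fst fun p hp => hp.1).prodMk continuousOn_snd
  refine ((continuous_iteratedDeriv_primitive m i).comp_continuousOn h).congr fun p _ => ?_
  rw [stretch_eq_primitive, Function.comp_apply]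

/-! ### Smooth inverses and open simplices -/

/-- A surjective smooth function with positive derivative is a smooth bijection whose inverse is
smooth too. -/
theorem exists_mem_diffR {f : ℝ → ℝ} (hf : ContDiff ℝ ∞ f) (hd : ∀ t, 0 < deriv f t)
    (hs : Function.Surjective f) : ∃ h : diffR, (h.1 : ℝ → ℝ) = f := by
  have hmono : StrictMono f := strictMono_of_deriv_pos hd
  obtain ⟨e, he⟩ : ∃ e : ℝ ≃ₜ ℝ, (e : ℝ → ℝ) = f :=
    ⟨(hmono.orderIsoOfSurjective f hs).toHomeomorph, rfl⟩
  subst he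
  exact ⟨⟨e.toEquiv, hf, e.contDiff_symm_deriv (fun t => (hd t).ne')
    (fun t => (hf.differentiable (by simp) t).hasDerivAt) hf⟩, rfl⟩

theorem isOpen_simplex (m : ℕ) (a b : ℝ) : IsOpen (simplex m a b) := by
  have : simplex m a b = (⋂ i : Fin m, ⋂ j : Fin m, {x | i < j → x i < x j}) ∩
      ⋂ i : Fin m, ({x | a < x i} ∩ {x | x i < b}) := by
    ext x
    simp [simplex, StrictMono]
  rw [this]
  refine IsOpen.inter (isOpen_iInter_of_finite fun i => isOpen_iInter_of_finite fun j => ?_)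
    (isOpen_iInter_of_finite fun i => ?_)
  · by_cases hij : i < j
    · simpa [hij] using isOpen_lt (continuous_apply i) (continuous_apply j)
    · simp [hij]
  · exact (isOpen_lt continuous_const (continuous_apply i)).inter
      (isOpen_lt (continuous_apply i) continuous_const)

theorem convex_simplex (m : ℕ) (a b : ℝ) : Convex ℝ (simplex m a b) := by
  rintro x hx y hy s t hs ht hst
  have key : ∀ u v w z : ℝ, u < v → w < z → s * u + t * w < s * v + t * z := by
    intro u v w z h1 h2
    rcases hs.eq_or_lt with rfl | hs
    · have : t = 1 := by linarith
      subst this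
      linarith
    · have := mul_lt_mul_of_pos_left h1 hs
      have := mul_le_mul_of_nonneg_left h2.le ht
      linarith
  have hcomb : ∀ u : ℝ, s * u + t * u = u := fun u => by rw [← add_mul, hst, one_mul]
  refine ⟨fun i j hij => key _ _ _ _ (hx.1 hij) (hy.1 hij), fun i => ⟨?_, ?_⟩⟩
  · have := key _ _ _ _ (hx.2 i).1 (hy.2 i).1
    rwa [hcomb] at this
  · have := key _ _ _ _ (hx.2 i).2 (hy.2 i).2
    rwa [hcomb] at this

/-- A nonempty open simplex is homeomorphic to a ball, hence to the whole space. -/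
theorem nonempty_simplex_homeomorph {m : ℕ} {a b : ℝ} (hne : (simplex m a b).Nonempty) :
    Nonempty (simplex m a b ≃ₜ (Fin m → ℝ)) := by
  have hb : Bornology.IsBounded (simplex m a b) :=
    (Metric.isBounded_Icc (fun _ => a) fun _ => b).subset fun x hx =>
      ⟨fun i => (hx.2 i).1.le, fun i => (hx.2 i).2.le⟩
  have hi := (isOpen_simplex m a b).interior_eq
  obtain ⟨e, he, -⟩ := exists_homeomorph_image_interior_closure_frontier_eq_unitBall
    (convex_simplex m a b) (by rwa [hi]) hb
  rw [hi] at he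
  exact ⟨(e.image _).trans ((Homeomorph.setCongr he).trans Homeomorph.unitBall.symm)⟩

/-! ### Coset spaces and continuous sections -/

/-- A continuous map on a group whose fibres are the left cosets of `H` and which has a continuous
section induces a homeomorphism on the space of cosets. -/
theorem exists_isHomeomorph_quotient {G Y ι : Type*} [Group G] {H : Subgroup G}
    [TopologicalSpace Y] (T : ι → TopologicalSpace G) {ev : G → Y} {σ : Y → G}
    (hfib : ∀ g h, ev g = ev h ↔ g⁻¹ * h ∈ H)
    (hev : ∀ r, Continuous[T r, inferInstance] ev)
    (hσ : ∀ r, Continuous[inferInstance, T r] σ) (hs : ∀ y, ev (σ y) = y) :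
    ∃ Φ : G ⧸ H → Y, (∀ h : G, Φ (QuotientGroup.mk h) = ev h) ∧
      ∀ r, @IsHomeomorph _ _ ((T r).coinduced QuotientGroup.mk) inferInstance Φ := by
  have hmk : ∀ g h : G, (QuotientGroup.mk g : G ⧸ H) = QuotientGroup.mk h ↔ ev g = ev h :=
    fun g h => by rw [hfib, QuotientGroup.eq]
  let Φ : G ⧸ H → Y := fun q => ev q.out
  have hΦ : ∀ h : G, Φ (QuotientGroup.mk h) = ev h := fun h =>
    (hmk _ _).1 (QuotientGroup.out_eq' _)
  refine ⟨Φ, hΦ, fun r => ?_⟩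
  let := T r
  let : TopologicalSpace (G ⧸ H) := (T r).coinduced QuotientGroup.mk
  refine isHomeomorph_iff_exists_inverse.2 ⟨?_, fun y => QuotientGroup.mk (σ y), ?_, ?_, ?_⟩
  · refine continuous_coinduced_dom.2 ?_
    rw [show Φ ∘ QuotientGroup.mk = ev from funext hΦ]
    exact hev r
  · intro q
    induction q using QuotientGroup.induction_on with
    | H g => rw [hΦ, hmk, hs]
  · intro y
    rw [hΦ, hs]
  · exact continuous_coinduced_rng.comp (hσ r)

theorem exists_isHomeomorph_comp {Q Y Z ι : Type*} [TopologicalSpace Y] [TopologicalSpace Z]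
    {T : ι → TopologicalSpace Q} {Φ : Q → Y} (hΦ : ∀ r, @IsHomeomorph _ _ (T r) inferInstance Φ)
    (e : Y ≃ₜ Z) : ∃ Ψ : Q → Z, ∀ r, @IsHomeomorph _ _ (T r) inferInstance Ψ :=
  ⟨e ∘ Φ, fun r => by
    let := T r
    exact e.isHomeomorph.comp (hΦ r)⟩

/-! ### The strong topology on the diffeomorphisms of the line -/

theorem continuous_eval_whitneyR (r : ℕ∞) (p : ℝ) :
    Continuous[whitneyR r, inferInstance] fun h : diffR => h.1 p := by
  let := whitneyR r
  refine continuous_iff_continuousAt.2 fun g => Metric.tendsto_nhds.2 fun δ hδ => ?_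
  have hopen : IsOpen (ballR 0 g fun _ => δ) := TopologicalSpace.isOpen_generateFrom_of_mem
    ⟨0, g, _, by simp, continuous_const, fun _ => hδ, rfl⟩
  have hmem : g ∈ ballR 0 g fun _ => δ := fun z => by simpa using hδ
  filter_upwards [hopen.mem_nhds hmem] with h hh
  have := hh p
  rw [Real.dist_eq, abs_sub_comm]
  simpa using this

/-- A family of diffeomorphisms supported in a fixed compact interval, all of whose derivatives are
jointly continuous, is continuous for the strong topologies: the inequality which defines a basic
neighbourhood does not depend on the parameter outside the interval, and on the interval it is
stable under small changes of the parameter. -/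
theorem continuous_whitneyR_of_support {X : Type*} [TopologicalSpace X] {σ : X → diffR} {a b : ℝ}
    (hid : ∀ x, ∀ t ∉ Icc a b, (σ x).1 t = t)
    (hσ : ∀ i, Continuous fun p : X × ℝ => iteratedDeriv i ((σ p.1).1 : ℝ → ℝ) p.2) (r : ℕ∞) :
    Continuous[inferInstance, whitneyR r] σ := by
  refine continuous_generateFrom_iff.2 ?_
  rintro _ ⟨k, g, ε, -, hε, -, rfl⟩
  refine isOpen_iff_mem_nhds.2 fun x₀ hx₀ => ?_
  have hg : ∀ i : ℕ, Continuous (iteratedDeriv i (g.1 : ℝ → ℝ)) := fun i =>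
    g.2.1.continuous_iteratedDeriv i (by exact_mod_cast le_top)
  have hK : ∀ᶠ x in 𝓝 x₀, ∀ t ∈ Icc a b, ∑ i ∈ Finset.range (k + 1),
      |iteratedDeriv i (g.1 : ℝ → ℝ) t - iteratedDeriv i ((σ x).1 : ℝ → ℝ) t| < ε t := by
    refine isCompact_Icc.eventually_forall_of_forall_eventually fun t _ => ?_
    have hc : Continuous fun p : X × ℝ => ∑ i ∈ Finset.range (k + 1),
        |iteratedDeriv i (g.1 : ℝ → ℝ) p.2 - iteratedDeriv i ((σ p.1).1 : ℝ → ℝ) p.2| :=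
      continuous_finsetSum _ fun i _ => (((hg i).comp continuous_snd).sub (hσ i)).abs
    exact (isOpen_lt hc (hε.comp continuous_snd)).mem_nhds (hx₀ t)
  filter_upwards [hK] with x hx t
  by_cases ht : t ∈ Icc a b
  · exact hx t ht
  · have heq : ((σ x).1 : ℝ → ℝ) =ᶠ[𝓝 t] ((σ x₀).1 : ℝ → ℝ) := by
      filter_upwards [isClosed_Icc.isOpen_compl.mem_nhds ht] with s hs
      rw [hid x s hs, hid x₀ s hs]
    simp_rw [fun i => heq.iteratedDeriv_eq i]
    exact hx₀ t

/-! ### Evaluation and its section on the line -/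

theorem diffRf_apply_one_and_natCast {n : ℕ} (hn : 1 ≤ n) (h : diffRf n) :
    h.1.1 1 = 1 ∧ h.1.1 n = n := by
  have hn' : (1 : ℝ) ≤ n := by exact_mod_cast hn
  obtain ⟨hm, -, hi⟩ := h.2
  have h1 : h.1.1 1 ∈ Icc (1 : ℝ) n := hi ▸ mem_image_of_mem _ (left_mem_Icc.2 hn')
  have h2 : h.1.1 n ∈ Icc (1 : ℝ) n := hi ▸ mem_image_of_mem _ (right_mem_Icc.2 hn')
  obtain ⟨s, hs, hs1⟩ : (1 : ℝ) ∈ (h.1.1 : ℝ → ℝ) '' Icc 1 (n : ℝ) := by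
    rw [hi]
    exact left_mem_Icc.2 hn'
  obtain ⟨t, ht, ht1⟩ : (n : ℝ) ∈ (h.1.1 : ℝ → ℝ) '' Icc 1 (n : ℝ) := by
    rw [hi]
    exact right_mem_Icc.2 hn'
  have h3 := hm.monotone hs.1
  have h4 := hm.monotone ht.2
  exact ⟨le_antisymm (hs1 ▸ h3) h1.1, le_antisymm h2.2 (ht1 ▸ h4)⟩

theorem evalR_mem_simplex {n : ℕ} (hn : 2 ≤ n) (h : diffRf n) :
    evalR n h ∈ simplex (n - 2) 1 n := by
  have hm : StrictMono (h.1.1 : ℝ → ℝ) := h.2.1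
  obtain ⟨h1, h2⟩ := diffRf_apply_one_and_natCast (by omega) h
  refine ⟨fun i j hij => hm ?_, fun i => ⟨?_, ?_⟩⟩
  · have : ((i : ℕ) : ℝ) < (j : ℕ) := by exact_mod_cast hij
    linarith
  · rw [← h1]
    refine hm ?_
    have : (0 : ℝ) ≤ (i : ℕ) := Nat.cast_nonneg _
    linarith
  · conv_rhs => rw [← h2]
    refine hm ?_
    have : (i : ℕ) + 2 < n := by omega
    exact_mod_cast this

theorem evalR_eq_iff {n : ℕ} (hn : 2 ≤ n) (g h : diffRf n) :
    evalR n g = evalR n h ↔ g⁻¹ * h ∈ diffRfe n := by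
  have hmem : g⁻¹ * h ∈ diffRfe n ↔ ∀ k : ℕ, 1 ≤ k → k ≤ n → h.1.1 k = g.1.1 k := by
    refine forall_congr' fun k => forall_congr' fun _ => forall_congr' fun _ => ?_
    change g.1.1.symm (h.1.1 k) = k ↔ _
    rw [Equiv.symm_apply_eq]
  obtain ⟨g1, gn⟩ := diffRf_apply_one_and_natCast (by omega) g
  obtain ⟨h1, hn'⟩ := diffRf_apply_one_and_natCast (by omega) h
  rw [hmem]
  refine ⟨fun he k hk hkn => ?_, fun he => funext fun i => ?_⟩
  · rcases hk.eq_or_lt with rfl | hk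
    · rw [Nat.cast_one, g1, h1]
    rcases hkn.eq_or_lt with rfl | hkn
    · rw [gn, hn']
    have := congrFun he ⟨k - 2, by omega⟩
    have hk2 : ((k - 2 : ℕ) : ℝ) + 2 = k := by
      rw [Nat.cast_sub (by omega)]
      norm_num
    simpa only [evalR, hk2] using this.symm
  · have := he (i + 2) (by omega) (by omega)
    push_cast at this
    exact this.symm

theorem addEnds_zero {n : ℕ} (hn : 0 < n) (x : Fin (n - 2) → ℝ) : addEnds n x ⟨0, hn⟩ = 1 := rfl

theorem addEnds_succ {n k : ℕ} (x : Fin (n - 2) → ℝ) (hk : k < n - 2) :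
    addEnds n x ⟨k + 1, by omega⟩ = x ⟨k, hk⟩ := by
  simp [addEnds, hk]

theorem addEnds_last {n k : ℕ} (x : Fin (n - 2) → ℝ) (hn : 2 ≤ n) (hk : k + 1 = n) :
    addEnds n x ⟨k, by omega⟩ = n := by
  have h0 : k ≠ 0 := by omega
  have h1 : ¬ k - 1 < n - 2 := by omega
  simp [addEnds, h0, h1]

theorem addEnds_mem_simplex {n : ℕ} (hn : 2 ≤ n) {x : Fin (n - 2) → ℝ}
    (hx : x ∈ simplex (n - 2) 1 n) : addEnds n x ∈ simplex n 0 ((n : ℝ) + 1) := by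
  have hn' : (2 : ℝ) ≤ n := by exact_mod_cast hn
  have hcase : ∀ i : Fin n, i = ⟨0, by omega⟩ ∨ (∃ (k : ℕ) (hk : k < n - 2),
      i = ⟨k + 1, by omega⟩) ∨ i = ⟨n - 1, by omega⟩ := by
    rintro ⟨i, hi⟩
    rcases Nat.eq_zero_or_pos i with rfl | h0
    · exact Or.inl rfl
    · by_cases h : i - 1 < n - 2
      · exact Or.inr (Or.inl ⟨i - 1, h, Fin.ext (by simp; omega)⟩)
      · exact Or.inr (Or.inr (Fin.ext (by simp; omega)))
  refine ⟨fun i j hij => ?_, fun i => ?_⟩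
  · rcases hcase i with rfl | ⟨k, hk, rfl⟩ | rfl <;>
    rcases hcase j with rfl | ⟨l, hl, rfl⟩ | rfl
    · exact absurd hij (lt_irrefl _)
    · rw [addEnds_zero, addEnds_succ x hl]
      exact (hx.2 _).1
    · rw [addEnds_zero, addEnds_last x hn (by omega)]
      linarith
    · simp at hij
    · rw [addEnds_succ x hk, addEnds_succ x hl]
      exact hx.1 (by simpa using hij)
    · rw [addEnds_succ x hk, addEnds_last x hn (by omega)]
      exact (hx.2 _).2
    · simp at hij
    · rw [Fin.mk_lt_mk] at hij
      omega
    · exact absurd hij (lt_irrefl _)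
  · rcases hcase i with rfl | ⟨k, hk, rfl⟩ | rfl
    · rw [addEnds_zero]
      constructor <;> linarith
    · rw [addEnds_succ x hk]
      have := hx.2 ⟨k, hk⟩
      constructor <;> linarith
    · rw [addEnds_last x hn (by omega)]
      constructor <;> linarith

theorem continuous_addEnds (n : ℕ) : Continuous (addEnds n) := by
  refine continuous_pi fun i => ?_
  unfold addEnds
  split_ifs <;> fun_prop

theorem stretch_surjective {m : ℕ} {x : Fin m → ℝ} (hx : x ∈ simplex m 0 ((m : ℝ) + 1)) :
    Function.Surjective (stretch m x) := by
  refine fun s => mem_range_of_exists_le_of_exists_ge (stretch_contDiff m x).continuous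
    ⟨min s 0, ?_⟩ ⟨max s (m + 1), ?_⟩
  · rw [stretch_of_le m x (min_le_right _ _)]
    exact min_le_left _ _
  · rw [stretch_of_ge hx (le_max_right _ _)]
    exact le_max_left _ _

theorem exists_diffRf_eq_stretch {n : ℕ} (hn : 2 ≤ n) (x : simplex (n - 2) 1 (n : ℝ)) :
    ∃ h : diffRf n, (h.1.1 : ℝ → ℝ) = stretch n (addEnds n x) := by
  have hx := addEnds_mem_simplex hn x.2
  obtain ⟨h, hh⟩ := exists_mem_diffR (stretch_contDiff n (addEnds n x))
    (deriv_stretch_pos n _) (stretch_surjective hx)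
  refine ⟨⟨h, ?_, ⟨Icc 0 ((n : ℝ) + 1), isCompact_Icc, fun t ht => ?_⟩, ?_⟩, hh⟩
  · rw [hh]
    exact stretch_strictMono _ _
  · rw [hh]
    rcases le_or_gt t 0 with h0 | h0
    · exact stretch_of_le _ _ h0
    · exact stretch_of_ge hx (not_lt.1 fun h1 => ht ⟨h0.le, h1.le⟩)
  · have h1 : stretch n (addEnds n x) 1 = 1 := by
      have := stretch_natCast hx (k := 1) (by omega)
      rw [Nat.cast_one, node_succ_of_lt _ (by omega)] at this
      rw [this, addEnds_zero]
    have h2 : stretch n (addEnds n x) n = n := by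
      obtain ⟨k, rfl⟩ : ∃ k, n = k + 1 := ⟨n - 1, by omega⟩
      have := stretch_natCast hx (k := k + 1) (by omega)
      rw [node_succ_of_lt _ (by omega), addEnds_last _ hn rfl] at this
      exact this
    have himage : stretch n (addEnds n x) '' Icc 1 (n : ℝ) =
        Icc (stretch n (addEnds n x) 1) (stretch n (addEnds n x) n) :=
      ((stretch_strictMono _ _).orderIsoOfSurjective _ (stretch_surjective hx)).image_Icc 1 (n : ℝ)
    rw [hh, himage, h1, h2]

theorem evalR_of_eq_stretch {n : ℕ} (hn : 2 ≤ n) (x : simplex (n - 2) 1 (n : ℝ)) {h : diffRf n}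
    (hh : (h.1.1 : ℝ → ℝ) = stretch n (addEnds n x)) : evalR n h = x := by
  funext i
  have := stretch_natCast (addEnds_mem_simplex hn x.2) (k := i + 1 + 1) (by omega)
  rw [node_succ_of_lt _ (by omega), addEnds_succ _ i.2] at this
  rw [evalR, hh, ← this]
  congr 1
  push_cast
  ring

theorem continuous_of_eq_stretch {n : ℕ} (hn : 2 ≤ n) {σ : simplex (n - 2) 1 (n : ℝ) → diffRf n}
    (hσ : ∀ x, ((σ x).1.1 : ℝ → ℝ) = stretch n (addEnds n x)) (r : ℕ∞) :
    Continuous[inferInstance, whitneyRf n r] σ := by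
  refine continuous_induced_rng.2 (continuous_whitneyR_of_support (a := 0) (b := (n : ℝ) + 1)
    (fun x t ht => ?_) (fun i => ?_) r)
  · rw [Function.comp_apply, hσ]
    rcases le_or_gt t 0 with h0 | h0
    · exact stretch_of_le _ _ h0
    · exact stretch_of_ge (addEnds_mem_simplex hn x.2) (not_lt.1 fun h1 => ht ⟨h0.le, h1.le⟩)
  · have hc : Continuous fun p : simplex (n - 2) 1 (n : ℝ) × ℝ => (addEnds n p.1, p.2) :=
      ((continuous_addEnds n).comp (continuous_subtype_val.comp continuous_fst)).prodMk
        continuous_snd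
    have hmem (p : simplex (n - 2) 1 (n : ℝ) × ℝ) :
        (addEnds n p.1, p.2) ∈ simplex n 0 ((n : ℝ) + 1) ×ˢ (univ : Set ℝ) :=
      mk_mem_prod (addEnds_mem_simplex hn p.1.2) (mem_univ _)
    refine ((continuousOn_iteratedDeriv_stretch n i).comp_continuous hc hmem).congr fun p => ?_
    change _ = iteratedDeriv i ((σ p.1).1.1 : ℝ → ℝ) p.2
    rw [hσ]
    rfl

theorem simplex_nonempty_line {n : ℕ} (hn : 2 ≤ n) : (simplex (n - 2) 1 (n : ℝ)).Nonempty :=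
  ⟨evalR n 1, evalR_mem_simplex hn 1⟩

/-- The statement for the line: evaluation is a homeomorphism from the coset space onto the simplex,
the stretching maps form a continuous section, and the simplex is a Euclidean space. -/
theorem line_case {n : ℕ} (hn : 2 ≤ n) :
    (∃ Φ : (diffRf n ⧸ diffRfe n) → simplex (n - 2) 1 (n : ℝ),
        (∀ h : diffRf n, (Φ (QuotientGroup.mk h) : Fin (n - 2) → ℝ) = evalR n h) ∧
        ∀ r : ℕ∞, @IsHomeomorph _ _ (whitneyRQuot n r) inferInstance Φ) ∧
    (∃ σ : simplex (n - 2) 1 (n : ℝ) → diffRf n,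
        (∀ x, evalR n (σ x) = x) ∧
        (∀ x, ∀ t : ℝ, (σ x).1.1 t = stretch n (addEnds n x) t) ∧
        ∀ r : ℕ∞, Continuous[inferInstance, whitneyRf n r] σ) ∧
    (∃ Ψ : (diffRf n ⧸ diffRfe n) → (Fin (n - 2) → ℝ),
        ∀ r : ℕ∞, @IsHomeomorph _ _ (whitneyRQuot n r) inferInstance Ψ) := by
  choose σ hσ using exists_diffRf_eq_stretch hn
  have hs : ∀ x, evalR n (σ x) = x := fun x => evalR_of_eq_stretch hn x (hσ x)
  have hcont := continuous_of_eq_stretch hn hσ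
  obtain ⟨Φ, hΦ, hhom⟩ := exists_isHomeomorph_quotient (whitneyRf n)
    (ev := fun h => (⟨evalR n h, evalR_mem_simplex hn h⟩ : simplex (n - 2) 1 (n : ℝ)))
    (σ := σ) (H := diffRfe n) (fun g h => Subtype.mk_eq_mk.trans (evalR_eq_iff hn g h))
    (fun r => by
      let := whitneyR r
      let := whitneyRf n r
      exact Continuous.subtype_mk (continuous_pi fun i =>
        (continuous_eval_whitneyR r _).comp continuous_induced_dom) _)
    hcont (fun x => Subtype.ext (hs x))
  obtain ⟨e⟩ := nonempty_simplex_homeomorph (simplex_nonempty_line hn)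
  exact ⟨⟨Φ, fun h => by rw [hΦ], hhom⟩, ⟨σ, hs, fun x t => by rw [hσ], hcont⟩,
    exists_isHomeomorph_comp hhom e⟩

/-! ### Lifts of circle maps -/

theorem coe_circle_eq_iff (n : ℕ) (s t : ℝ) :
    (s : AddCircle (n : ℝ)) = t ↔ ∃ k : ℤ, s = t + k * n := by
  rw [← sub_eq_zero, ← AddCircle.coe_sub, AddCircle.coe_eq_zero_iff]
  refine exists_congr fun k => ?_
  rw [zsmul_eq_mul, eq_sub_iff_add_eq, add_comm, eq_comm]

theorem coe_add_int_mul (n : ℕ) (t : ℝ) (k : ℤ) :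
    ((t + k * n : ℝ) : AddCircle (n : ℝ)) = t :=
  (coe_circle_eq_iff n _ _).2 ⟨k, rfl⟩

theorem coe_natCast_circle (n : ℕ) : ((n : ℝ) : AddCircle (n : ℝ)) = 0 := AddCircle.coe_period _

/-- Two continuous lifts of the same map differ by an integral multiple of the period, since their
difference is continuous with values in a discrete set. -/
theorem IsLift.exists_eq_add {n : ℕ} (hn : 1 ≤ n) {f : AddCircle (n : ℝ) → AddCircle (n : ℝ)}
    {F G : ℝ → ℝ} (hF : IsLift n f F) (hG : IsLift n f G) (cF : Continuous F)
    (cG : Continuous G) : ∃ k : ℤ, ∀ t, F t = G t + k * n := by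
  have hn' : (n : ℝ) ≠ 0 := by positivity
  have h : ∀ t, ∃ k : ℤ, F t = G t + k * n := fun t =>
    (coe_circle_eq_iff n _ _).1 ((hF t).symm.trans (hG t))
  choose k hk using h
  have hc : Continuous k := by
    rw [Int.isClosedEmbedding_coe_real.isEmbedding.continuous_iff]
    have : ((fun z : ℤ => (z : ℝ)) ∘ k) = fun t => (F t - G t) / n := by
      funext t
      rw [Function.comp_apply, hk t]
      field_simp
      ring
    rw [this]
    fun_prop
  exact ⟨k 0, fun t => by rw [hk t, PreconnectedSpace.constant inferInstance hc (x := t) (y := 0)]⟩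

/-- The increasing lift of an injective circle map has degree one: a larger degree would make it
take some value of the circle twice within a period. -/
theorem IsLift.strictMono_add_period {n : ℕ} (hn : 1 ≤ n)
    {f : AddCircle (n : ℝ) → AddCircle (n : ℝ)} (hf : Function.Injective f) {F : ℝ → ℝ}
    (hF : IsLift n f F) (cF : Continuous F) (mF : StrictMono F) (t : ℝ) :
    F (t + n) = F t + n := by
  have hn' : (0 : ℝ) < n := by positivity
  have h1 : (F (t + n) : AddCircle (n : ℝ)) = F t := by
    rw [← hF, ← hF, AddCircle.coe_add_period]
  obtain ⟨k, hk⟩ := (coe_circle_eq_iff n _ _).1 h1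
  have hk0 : 0 < k := by
    have h2 : F t < F (t + n) := mF (by linarith)
    have h3 : (0 : ℝ) < k * n := by linarith
    exact_mod_cast pos_of_mul_pos_left h3 hn'.le
  rcases (show 1 ≤ k by omega).eq_or_lt with rfl | hk1
  · rw [hk, Int.cast_one, one_mul]
  exfalso
  have hk2 : (1 : ℝ) < k := by exact_mod_cast hk1
  have hlt : F t + n < F (t + n) := by
    rw [hk]
    nlinarith
  obtain ⟨s, hs, hs'⟩ := intermediate_value_Icc (by linarith : t ≤ t + n) cF.continuousOn
    ⟨by linarith, hlt.le⟩
  have h2 : f s = f t := by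
    rw [hF, hF, hs', AddCircle.coe_add_period]
  obtain ⟨j, hj⟩ := (coe_circle_eq_iff n _ _).1 (hf h2)
  have h3 : t < s := mF.lt_iff_lt.1 (by linarith)
  have h4 : s < t + n := mF.lt_iff_lt.1 (by linarith)
  have h5 : (0 : ℝ) < j := pos_of_mul_pos_left (by linarith : (0 : ℝ) < j * n) hn'.le
  have h6 : (j : ℝ) < 1 := lt_of_mul_lt_mul_right (by linarith : (j : ℝ) * n < 1 * n) hn'.le
  have h7 : 0 < j := by exact_mod_cast h5
  have h8 : j < 1 := by exact_mod_cast h6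
  omega

theorem IsLift.add_period {n : ℕ} (hn : 1 ≤ n) {h : diffS n} {F : ℝ → ℝ}
    (hF : IsLift n h.1 F) (cF : Continuous F) (t : ℝ) : F (t + n) = F t + n := by
  obtain ⟨⟨G, cG, mG, lG⟩, -⟩ := h.2
  obtain ⟨k, hk⟩ := hF.exists_eq_add hn lG cF cG.continuous
  rw [hk, hk, lG.strictMono_add_period hn h.1.injective cG.continuous mG]
  ring

theorem add_int_mul_period {n : ℕ} {F : ℝ → ℝ} (hF : ∀ t, F (t + n) = F t + n) (k : ℤ) (t : ℝ) :
    F (t + k * n) = F t + k * n := by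
  have h : Function.Periodic (fun t => F t - t) (n : ℝ) := fun t => by
    simp only [hF]
    ring
  have : F (t + k * n) - (t + k * n) = F t - t := h.int_mul k t
  linarith

/-- A smooth function with positive derivative which commutes with the translation by the period is
the lift of a diffeomorphism of the circle. -/
theorem exists_mem_diffS {n : ℕ} (hn : 1 ≤ n) {F : ℝ → ℝ} (hF : ContDiff ℝ ∞ F)
    (hd : ∀ t, 0 < deriv F t) (hp : ∀ t, F (t + n) = F t + n) :
    ∃ h : diffS n, IsLift n h.1 F := by
  have hn' : (0 : ℝ) < n := by positivity
  have hs : Function.Surjective F := by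
    intro s
    refine mem_range_of_exists_le_of_exists_ge hF.continuous
      ⟨0 + (⌊(s - F 0) / n⌋ : ℤ) * n, ?_⟩ ⟨0 + (⌈(s - F 0) / n⌉ : ℤ) * n, ?_⟩
    · rw [add_int_mul_period hp]
      have := (le_div_iff₀ hn').1 (Int.floor_le ((s - F 0) / n))
      linarith
    · rw [add_int_mul_period hp]
      have := (div_le_iff₀ hn').1 (Int.le_ceil ((s - F 0) / n))
      linarith
  obtain ⟨h, rfl⟩ := exists_mem_diffR hF hd hs
  have hmono : StrictMono (h.1 : ℝ → ℝ) := strictMono_of_deriv_pos hd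
  have hmono' : StrictMono (h.1.symm : ℝ → ℝ) := fun s t hst => by
    rw [← hmono.lt_iff_lt]
    simpa using hst
  have hp' : ∀ t, h.1.symm (t + n) = h.1.symm t + n := fun t => by
    rw [Equiv.symm_apply_eq, hp, Equiv.apply_symm_apply]
  have per : Function.Periodic (fun t => (h.1 t : AddCircle (n : ℝ))) (n : ℝ) := fun t => by
    simp only [hp, AddCircle.coe_add_period]
  have per' : Function.Periodic (fun t => (h.1.symm t : AddCircle (n : ℝ))) (n : ℝ) := fun t => by
    simp only [hp', AddCircle.coe_add_period]
  let e : Equiv.Perm (AddCircle (n : ℝ)) :=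
    { toFun := per.lift
      invFun := per'.lift
      left_inv := fun z => by
        induction z using QuotientAddGroup.induction_on with
        | H t =>
          rw [per.lift_coe, per'.lift_coe, Equiv.symm_apply_apply]
      right_inv := fun z => by
        induction z using QuotientAddGroup.induction_on with
        | H t =>
          rw [per'.lift_coe, per.lift_coe, Equiv.apply_symm_apply] }
  exact ⟨⟨e, ⟨h.1, h.2.1, hmono, fun t => per.lift_coe t⟩,
    ⟨h.1.symm, h.2.2, hmono', fun t => per'.lift_coe t⟩⟩, fun t => per.lift_coe t⟩

/-! ### The strong topology on the diffeomorphisms of the circle -/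

theorem mem_ballS_self {n k : ℕ} (g : diffS n) {ε : AddCircle (n : ℝ) → ℝ} (hε : ∀ z, 0 < ε z) :
    g ∈ ballS n k g ε := by
  obtain ⟨⟨G, cG, -, lG⟩, -⟩ := g.2
  exact ⟨G, G, cG, lG, cG, lG, fun t => by simpa using hε t⟩

theorem continuous_eval_whitneyS (n : ℕ) (r : ℕ∞) (p : ℝ) :
    Continuous[whitneyS n r, inferInstance] fun h : diffS n => h.1 (p : AddCircle (n : ℝ)) := by
  let := whitneyS n r
  refine continuous_iff_continuousAt.2 fun g => Metric.tendsto_nhds.2 fun δ hδ => ?_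
  have hopen : IsOpen (ballS n 0 g fun _ => δ) := TopologicalSpace.isOpen_generateFrom_of_mem
    ⟨0, g, _, by simp, continuous_const, fun _ => hδ, rfl⟩
  filter_upwards [hopen.mem_nhds (mem_ballS_self g fun _ => hδ)] with h hh
  obtain ⟨G, H, -, lG, -, lH, hGH⟩ := hh
  rw [dist_comm, lG, lH, dist_eq_norm, ← AddCircle.coe_sub]
  refine QuotientAddGroup.norm_mk_le_norm.trans_lt ?_
  simpa using hGH p

theorem iteratedDeriv_add_const_apply (i : ℕ) (f : ℝ → ℝ) (c t : ℝ) :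
    iteratedDeriv i (fun s => f s + c) t = iteratedDeriv i f t + if i = 0 then c else 0 := by
  cases i with
  | zero => simp
  | succ i =>
    rw [iteratedDeriv_succ', iteratedDeriv_succ']
    simp

theorem iteratedDeriv_translate {n : ℕ} {F : ℝ → ℝ} (hF : ∀ t, F (t + n) = F t + n) (i : ℕ)
    (k : ℤ) (t : ℝ) : iteratedDeriv i F (t + k * n) =
      iteratedDeriv i F t + if i = 0 then (k * n : ℝ) else 0 := by
  rw [← iteratedDeriv_add_const_apply]
  simp_rw [← add_int_mul_period hF k]
  rw [iteratedDeriv_comp_add_const]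

/-- A family of circle diffeomorphisms with lifts all of whose derivatives are jointly continuous
near a period is continuous for the strong topologies, because the inequality which defines a basic
neighbourhood need only be checked on the compact interval `[-n/2, n/2]`. -/
theorem continuous_whitneyS_of_lift {n : ℕ} (hn : 1 ≤ n) {X : Type*} [TopologicalSpace X]
    {τ : X → diffS n} {F : X → ℝ → ℝ} (hF : ∀ x, ContDiff ℝ ∞ (F x))
    (hlift : ∀ x, IsLift n (τ x).1 (F x))
    (hcont : ∀ i, ContinuousOn (fun p : X × ℝ => iteratedDeriv i (F p.1) p.2)
      (univ ×ˢ Ioo (-n : ℝ) n)) (r : ℕ∞) :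
    Continuous[inferInstance, whitneyS n r] τ := by
  have hn' : (0 : ℝ) < n := by positivity
  refine continuous_generateFrom_iff.2 ?_
  rintro _ ⟨k, g, ε, -, hε, -, rfl⟩
  refine isOpen_iff_mem_nhds.2 fun x₀ hx₀ => ?_
  obtain ⟨G, H, cG, lG, cH, lH, hGH⟩ := hx₀
  obtain ⟨j, hj⟩ := lH.exists_eq_add hn (hlift x₀) cH.continuous (hF x₀).continuous
  -- the lift of the nearby diffeomorphism which is close to `G`
  let H' : X → ℝ → ℝ := fun x t => F x t + j * n
  have hH' : H' x₀ = H := funext fun t => (hj t).symm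
  have cH' : ∀ x, ContDiff ℝ ∞ (H' x) := fun x => (hF x).add contDiff_const
  have lH' : ∀ x, IsLift n (τ x).1 (H' x) := fun x t => by
    rw [hlift x t, coe_add_int_mul]
  have hG : ∀ i : ℕ, Continuous (iteratedDeriv i G) := fun i =>
    cG.continuous_iteratedDeriv i (by exact_mod_cast le_top)
  have hK : ∀ᶠ x in 𝓝 x₀, ∀ t ∈ Icc (-(n / 2 : ℝ)) (n / 2), ∑ i ∈ Finset.range (k + 1),
      |iteratedDeriv i G t - iteratedDeriv i (H' x) t| < ε (t : AddCircle (n : ℝ)) := by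
    refine isCompact_Icc.eventually_forall_of_forall_eventually fun t ht => ?_
    have hnhds : (univ ×ˢ Ioo (-n : ℝ) n : Set (X × ℝ)) ∈ 𝓝 (x₀, t) :=
      (isOpen_univ.prod isOpen_Ioo).mem_nhds
        ⟨mem_univ _, by linarith [ht.1], by linarith [ht.2]⟩
    have hc : ContinuousAt (fun p : X × ℝ => ∑ i ∈ Finset.range (k + 1),
        |iteratedDeriv i G p.2 - iteratedDeriv i (H' p.1) p.2|) (x₀, t) := by
      refine tendsto_finsetSum _ fun i _ => ?_
      refine ContinuousAt.abs (((hG i).comp continuous_snd).continuousAt.sub ?_)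
      simp_rw [H', iteratedDeriv_add_const_apply]
      exact ((hcont i).continuousAt hnhds).add continuousAt_const
    have hε' : ContinuousAt (fun p : X × ℝ => ε (p.2 : AddCircle (n : ℝ))) (x₀, t) :=
      (hε.comp ((AddCircle.continuous_mk' (n : ℝ)).comp continuous_snd)).continuousAt
    refine hc.eventually_lt hε' ?_
    simpa only [hH'] using hGH t
  filter_upwards [hK] with x hx
  refine ⟨G, H' x, cG, lG, cH' x, lH' x, fun t => ?_⟩
  have hround := abs_le.1 (abs_sub_round (t / n))
  have h1 : t / n * n = t := div_mul_cancel₀ _ hn'.ne'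
  have hmem : t - round (t / n) * n ∈ Icc (-(n / 2 : ℝ)) (n / 2) := by
    constructor <;> nlinarith
  have := hx _ hmem
  rw [← coe_add_int_mul n _ (round (t / n)), sub_add_cancel] at this
  convert this using 3 with i
  have hteq : t = t - round (t / n) * n + (round (t / n) : ℤ) * n := by ring
  conv_lhs => rw [hteq]
  rw [iteratedDeriv_translate (lG.add_period hn cG.continuous),
    iteratedDeriv_translate ((lH' x).add_period hn (cH' x).continuous)]
  exact add_sub_add_right_eq_sub _ _ _

/-! ### Extension of maps of an interval to lifts of circle maps -/

/-- The extension of the restriction of `f` to `[0, n)` which commutes with the translation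
by `n`. -/
noncomputable def wrap (n : ℕ) (f : ℝ → ℝ) (t : ℝ) : ℝ :=
  f (t - ⌊t / n⌋ * n) + ⌊t / n⌋ * n

theorem wrap_add_period {n : ℕ} (hn : 1 ≤ n) (f : ℝ → ℝ) (t : ℝ) :
    wrap n f (t + n) = wrap n f t + n := by
  have hn' : (n : ℝ) ≠ 0 := by positivity
  have : ⌊(t + n) / n⌋ = ⌊t / n⌋ + 1 := by
    rw [add_div, div_self hn', Int.floor_add_one]
  rw [wrap, wrap, this]
  push_cast
  ring_nf

theorem wrap_of_mem_Ico {n : ℕ} (f : ℝ → ℝ) {t : ℝ} (ht : t ∈ Ico (0 : ℝ) n) :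
    wrap n f t = f t := by
  have hn' : (0 : ℝ) < n := ht.1.trans_lt ht.2
  have : ⌊t / n⌋ = 0 :=
    Int.floor_eq_zero_iff.2 ⟨div_nonneg ht.1 hn'.le, (div_lt_one hn').2 ht.2⟩
  simp [wrap, this]

/-- If `f` is the identity outside `[0, n]`, then `t ↦ f t + f (t + n) - (t + n)` agrees with the
extension of `f` on two consecutive periods, which exhibits its smoothness at `0`. -/
theorem wrap_of_mem_Ioo {n : ℕ} (hn : 1 ≤ n) {f : ℝ → ℝ} (h0 : ∀ t ≤ 0, f t = t)
    (h1 : ∀ t, (n : ℝ) ≤ t → f t = t) {t : ℝ} (ht : t ∈ Ioo (-n : ℝ) n) :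
    wrap n f t = f t + f (t + n) - (t + n) := by
  rcases le_or_gt 0 t with h | h
  · rw [wrap_of_mem_Ico f ⟨h, ht.2⟩, h1 (t + n) (by linarith)]
    ring
  · have := wrap_add_period hn f t
    rw [wrap_of_mem_Ico f ⟨by linarith [ht.1], by linarith⟩] at this
    rw [this, h0 t h.le]
    ring

theorem wrap_of_mem_Icc {n : ℕ} (hn : 1 ≤ n) {f : ℝ → ℝ} (h0 : ∀ t ≤ 0, f t = t)
    (h1 : ∀ t, (n : ℝ) ≤ t → f t = t) {t : ℝ} (ht : t ∈ Icc (0 : ℝ) n) : wrap n f t = f t := by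
  have hn' : (0 : ℝ) < n := by positivity
  rcases ht.2.eq_or_lt with rfl | h
  · have := wrap_add_period hn f 0
    rw [zero_add, wrap_of_mem_Ico f ⟨le_rfl, hn'⟩, h0 0 le_rfl, zero_add] at this
    rw [this, h1 n le_rfl]
  · exact wrap_of_mem_Ico f ⟨ht.1, h⟩

theorem wrap_eventuallyEq {n : ℕ} (hn : 1 ≤ n) {f : ℝ → ℝ} (h0 : ∀ t ≤ 0, f t = t)
    (h1 : ∀ t, (n : ℝ) ≤ t → f t = t) {t : ℝ} (ht : t ∈ Ioo (-n : ℝ) n) :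
    wrap n f =ᶠ[𝓝 t] fun t => f t + f (t + n) - (t + n) := by
  filter_upwards [isOpen_Ioo.mem_nhds ht] with s hs
  exact wrap_of_mem_Ioo hn h0 h1 hs

theorem iteratedDeriv_wrap {n : ℕ} (hn : 1 ≤ n) {f : ℝ → ℝ} (hf : ContDiff ℝ ∞ f)
    (h0 : ∀ t ≤ 0, f t = t) (h1 : ∀ t, (n : ℝ) ≤ t → f t = t) (i : ℕ) {t : ℝ}
    (ht : t ∈ Ioo (-n : ℝ) n) :
    iteratedDeriv i (wrap n f) t =
      iteratedDeriv i f t + iteratedDeriv i f (t + n) - iteratedDeriv i id (t + n) := by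
  have hfi : ContDiff ℝ i f := hf.of_le (by exact_mod_cast le_top)
  have hfn : ContDiff ℝ i fun t => f (t + n) := hfi.comp (by fun_prop)
  rw [(wrap_eventuallyEq hn h0 h1 ht).iteratedDeriv_eq,
    iteratedDeriv_fun_sub (f := fun t => f t + f (t + n)) (hfi.add hfn).contDiffAt (by fun_prop),
    iteratedDeriv_fun_add hfi.contDiffAt hfn.contDiffAt, iteratedDeriv_comp_add_const]
  have := congrFun (iteratedDeriv_comp_add_const i (id : ℝ → ℝ) (n : ℝ)) t
  simp only [id] at this
  rw [this]

/-- The extension commutes with translations, so it has near every point, up to translation, the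
form that it has near a point of `[0, n)`. -/
theorem wrap_eq_translate {n : ℕ} (hn : 1 ≤ n) (f : ℝ → ℝ) (k : ℤ) :
    wrap n f = fun t => wrap n f (t + k * n) + -(k * n) := by
  funext t
  rw [add_int_mul_period (wrap_add_period hn f)]
  ring

theorem exists_translate_mem {n : ℕ} (hn : 1 ≤ n) (t : ℝ) :
    ∃ k : ℤ, t + k * n ∈ Ioo (-n : ℝ) n := by
  have hn' : (0 : ℝ) < n := by positivity
  refine ⟨-⌊t / n⌋, ?_⟩
  have h1 := (le_div_iff₀ hn').1 (Int.floor_le (t / n))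
  have h2 := (div_lt_iff₀ hn').1 (Int.lt_floor_add_one (t / n))
  push_cast
  constructor <;> linarith

theorem wrap_contDiff {n : ℕ} (hn : 1 ≤ n) {f : ℝ → ℝ} (hf : ContDiff ℝ ∞ f)
    (h0 : ∀ t ≤ 0, f t = t) (h1 : ∀ t, (n : ℝ) ≤ t → f t = t) : ContDiff ℝ ∞ (wrap n f) := by
  refine contDiff_iff_contDiffAt.2 fun t => ?_
  obtain ⟨k, hk⟩ := exists_translate_mem hn t
  have hloc : ContDiffAt ℝ ∞ (wrap n f) (t + k * n) := by
    refine ContDiffAt.congr_of_eventuallyEq ?_ (wrap_eventuallyEq hn h0 h1 hk)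
    exact ((hf.add (hf.comp (by fun_prop))).sub (by fun_prop)).contDiffAt
  rw [wrap_eq_translate hn f k]
  exact (hloc.comp (f := fun t : ℝ => t + k * n) t (by fun_prop)).add contDiffAt_const

theorem deriv_wrap_pos {n : ℕ} (hn : 1 ≤ n) {f : ℝ → ℝ} (hf : ContDiff ℝ ∞ f)
    (hd : ∀ t, 0 < deriv f t)
    (h0 : ∀ t ≤ 0, f t = t) (h1 : ∀ t, (n : ℝ) ≤ t → f t = t) (t : ℝ) :
    0 < deriv (wrap n f) t := by
  -- at `0` and `n` the derivative of `f` agrees with the one-sided derivative of the identity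
  have hd0 : ∀ t ≤ 0, deriv f t = 1 := fun t ht =>
    (uniqueDiffWithinAt_Iic t).eq_deriv _
      (hf.differentiable (by simp) t).hasDerivAt.hasDerivWithinAt
      ((hasDerivWithinAt_id t (Iic t)).congr (fun s hs => h0 s (le_trans hs ht)) (h0 t ht))
  have hd1 : ∀ t, (n : ℝ) ≤ t → deriv f t = 1 := fun t ht =>
    (uniqueDiffWithinAt_Ici t).eq_deriv _
      (hf.differentiable (by simp) t).hasDerivAt.hasDerivWithinAt
      ((hasDerivWithinAt_id t (Ici t)).congr (fun s hs => h1 s (le_trans ht hs)) (h1 t ht))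
  obtain ⟨k, hk⟩ := exists_translate_mem hn t
  rw [wrap_eq_translate hn f k, deriv_add_const, deriv_comp_add_const]
  have := iteratedDeriv_wrap hn hf h0 h1 1 hk
  simp only [iteratedDeriv_one, deriv_id] at this
  rw [this]
  rcases le_or_gt 0 (t + k * n) with h | h
  · rw [hd1 (t + k * n + n) (by linarith)]
    linarith [hd (t + k * n)]
  · rw [hd0 (t + k * n) h.le]
    linarith [hd (t + k * n + n)]

/-! ### The component of the configuration space of the circle -/

theorem natCast_pred_add_one {n : ℕ} (hn : 1 ≤ n) : ((n - 1 : ℕ) : ℝ) + 1 = n := by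
  rw [Nat.cast_sub hn]
  simp

theorem rotate_of_lt {n k : ℕ} (x : Fin (n - 1) → ℝ) (θ : AddCircle (n : ℝ)) (hk : k < n - 1) :
    rotate n x θ ⟨k, by omega⟩ = (x ⟨k, hk⟩ : AddCircle (n : ℝ)) + θ := by
  simp [rotate, hk]

theorem rotate_last {n : ℕ} (hn : 1 ≤ n) (x : Fin (n - 1) → ℝ) (θ : AddCircle (n : ℝ)) :
    rotate n x θ ⟨n - 1, by omega⟩ = θ := by
  simp [rotate]

theorem eq_mk_or_eq_last {n : ℕ} (hn : 1 ≤ n) (i : Fin n) :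
    (∃ (k : ℕ) (hk : k < n - 1), i = ⟨k, by omega⟩) ∨
      i = ⟨n - 1, by omega⟩ := by
  obtain ⟨i, hi⟩ := i
  by_cases h : i < n - 1
  · exact Or.inl ⟨i, h, rfl⟩
  · exact Or.inr (Fin.ext (by simp; omega))

theorem continuous_rotate (n : ℕ) :
    Continuous fun p : (Fin (n - 1) → ℝ) × AddCircle (n : ℝ) => rotate n p.1 p.2 := by
  refine continuous_pi fun i => ?_
  unfold rotate
  split_ifs with h
  · exact ((AddCircle.continuous_mk' (n : ℝ)).comp
      ((continuous_apply _).comp continuous_fst)).add continuous_snd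
  · exact continuous_snd

/-- The representatives in `[0, n)` of the differences `yᵢ - yₙ`, `i < n`: the positions of the
first `n - 1` points after the circle is rotated so that the last point comes to `0`. -/
noncomputable def gaps {n : ℕ} (hn : 1 ≤ n) (y : Fin n → AddCircle (n : ℝ)) :
    Fin (n - 1) → ℝ := fun i =>
  haveI : Fact ((0 : ℝ) < n) := ⟨by positivity⟩
  AddCircle.equivIco (n : ℝ) 0 (y ⟨i, by omega⟩ - y ⟨n - 1, by omega⟩)

theorem gaps_mem_Ico {n : ℕ} (hn : 1 ≤ n) (y : Fin n → AddCircle (n : ℝ)) (i : Fin (n - 1)) :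
    gaps hn y i ∈ Ico (0 : ℝ) n := by
  have : Fact ((0 : ℝ) < n) := ⟨by positivity⟩
  have := (AddCircle.equivIco (n : ℝ) 0 (y ⟨i, by omega⟩ - y ⟨n - 1, by omega⟩)).2
  exact ⟨this.1, this.2.trans_eq (zero_add _)⟩

theorem coe_gaps {n : ℕ} (hn : 1 ≤ n) (y : Fin n → AddCircle (n : ℝ)) (i : Fin (n - 1)) :
    (gaps hn y i : AddCircle (n : ℝ)) = y ⟨i, by omega⟩ - y ⟨n - 1, by omega⟩ := by
  have : Fact ((0 : ℝ) < n) := ⟨by positivity⟩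
  exact AddCircle.coe_equivIco

theorem rotate_gaps {n : ℕ} (hn : 1 ≤ n) (y : Fin n → AddCircle (n : ℝ)) :
    rotate n (gaps hn y) (y ⟨n - 1, by omega⟩) = y := by
  funext i
  rcases eq_mk_or_eq_last hn i with ⟨k, hk, rfl⟩ | rfl
  · rw [rotate_of_lt _ _ hk, coe_gaps, sub_add_cancel]
  · rw [rotate_last hn]

theorem gaps_rotate {n : ℕ} (hn : 1 ≤ n) {x : Fin (n - 1) → ℝ} (hx : x ∈ simplex (n - 1) 0 n)
    (θ : AddCircle (n : ℝ)) : gaps hn (rotate n x θ) = x := by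
  have : Fact ((0 : ℝ) < n) := ⟨by positivity⟩
  funext i
  rw [gaps, rotate_of_lt x θ i.2, rotate_last hn, add_sub_cancel_right]
  exact AddCircle.equivIco_coe_of_mem (by
    rw [zero_add]
    exact ⟨(hx.2 i).1.le, (hx.2 i).2⟩)

theorem eq_of_coe_eq {n : ℕ} {s t : ℝ} (hs : s ∈ Ico (0 : ℝ) n) (ht : t ∈ Ico (0 : ℝ) n)
    (h : (s : AddCircle (n : ℝ)) = t) : s = t := by
  have : Fact ((0 : ℝ) < n) := ⟨hs.1.trans_lt hs.2⟩
  have : (AddCircle.equivIco (n : ℝ) 0 s : ℝ) = AddCircle.equivIco (n : ℝ) 0 t := by rw [h]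
  rwa [AddCircle.equivIco_coe_of_mem (by rwa [zero_add]),
    AddCircle.equivIco_coe_of_mem (by rwa [zero_add])] at this

theorem rotate_mem_confS {n : ℕ} (hn : 1 ≤ n) {x : Fin (n - 1) → ℝ}
    (hx : x ∈ simplex (n - 1) 0 n) (θ : AddCircle (n : ℝ)) : rotate n x θ ∈ confS n := by
  have hn' : (0 : ℝ) < n := by positivity
  have hI : ∀ i, x i ∈ Ico (0 : ℝ) n := fun i => ⟨(hx.2 i).1.le, (hx.2 i).2⟩
  have h0 : ∀ i, (x i : AddCircle (n : ℝ)) ≠ 0 := fun i h =>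
    (hx.2 i).1.ne' (eq_of_coe_eq (hI i) ⟨le_rfl, hn'⟩ (by rw [h, AddCircle.coe_zero]))
  intro i j hij
  rcases eq_mk_or_eq_last hn i with ⟨k, hk, rfl⟩ | rfl <;>
    rcases eq_mk_or_eq_last hn j with ⟨l, hl, rfl⟩ | rfl
  · rw [rotate_of_lt _ _ hk, rotate_of_lt _ _ hl] at hij
    have := hx.1.injective (eq_of_coe_eq (hI _) (hI _) (add_right_cancel hij))
    simpa using this
  · rw [rotate_of_lt _ _ hk, rotate_last hn] at hij
    exact absurd (add_eq_right.1 hij) (h0 _)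
  · rw [rotate_of_lt _ _ hl, rotate_last hn] at hij
    exact absurd (right_eq_add.1 hij) (h0 _)
  · rfl

theorem sub_last_ne_zero {n : ℕ} (hn : 1 ≤ n) {y : Fin n → AddCircle (n : ℝ)} (hy : y ∈ confS n)
    (i : Fin (n - 1)) : y ⟨i, by omega⟩ - y ⟨n - 1, by omega⟩ ≠ 0 := by
  rw [sub_ne_zero]
  intro h
  have := congrArg Fin.val (hy h)
  simp only at this
  omega

theorem gaps_mem_Ioo {n : ℕ} (hn : 1 ≤ n) {y : Fin n → AddCircle (n : ℝ)} (hy : y ∈ confS n)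
    (i : Fin (n - 1)) : gaps hn y i ∈ Ioo (0 : ℝ) n := by
  have h := gaps_mem_Ico hn y i
  refine ⟨lt_of_le_of_ne h.1 fun h0 => sub_last_ne_zero hn hy i ?_, h.2⟩
  rw [← coe_gaps hn y i, ← h0, AddCircle.coe_zero]

theorem gaps_injective {n : ℕ} (hn : 1 ≤ n) {y : Fin n → AddCircle (n : ℝ)} (hy : y ∈ confS n) :
    Function.Injective (gaps hn y) := by
  intro i j hij
  have := congrArg (fun t : ℝ => (t : AddCircle (n : ℝ))) hij
  simp only [coe_gaps] at this
  have := hy (sub_left_injective this)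
  exact Fin.ext (by simpa using this)

theorem continuousOn_gaps {n : ℕ} (hn : 1 ≤ n) : ContinuousOn (gaps hn) (confS n) := by
  have : Fact ((0 : ℝ) < n) := ⟨by positivity⟩
  refine continuousOn_pi.2 fun i y hy => ContinuousAt.continuousWithinAt ?_
  have h0 : y ⟨i, by omega⟩ - y ⟨n - 1, by omega⟩ ≠ ((0 : ℝ) : AddCircle (n : ℝ)) := by
    rw [AddCircle.coe_zero]
    exact sub_last_ne_zero hn hy i
  have h1 : ContinuousAt (fun z => (AddCircle.equivIco (n : ℝ) 0 z : ℝ)) _ :=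
    continuous_subtype_val.continuousAt.comp (AddCircle.continuousAt_equivIco (n : ℝ) 0 h0)
  have h2 : ContinuousAt (fun y : Fin n → AddCircle (n : ℝ) =>
    y ⟨i, by omega⟩ - y ⟨n - 1, by omega⟩) y := by fun_prop
  exact h1.comp (f := fun y : Fin n → AddCircle (n : ℝ) =>
    y ⟨i, by omega⟩ - y ⟨n - 1, by omega⟩) h2

/-- The standard position of the first `n - 1` points. -/
theorem natCast_add_one_mem_simplex (n : ℕ) :
    (fun i : Fin (n - 1) => ((i : ℕ) : ℝ) + 1) ∈ simplex (n - 1) 0 n := by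
  refine ⟨fun i j hij => ?_, fun i => ⟨by positivity, ?_⟩⟩
  · have : ((i : ℕ) : ℝ) < (j : ℕ) := by exact_mod_cast hij
    linarith
  · have : (i : ℕ) + 1 < n := by omega
    change ((i : ℕ) : ℝ) + 1 < n
    exact_mod_cast this

theorem rotate_natCast_add_one {n : ℕ} (hn : 1 ≤ n) :
    rotate n (fun i : Fin (n - 1) => ((i : ℕ) : ℝ) + 1) 0 =
      fun i : Fin n => ((((i : ℕ) : ℝ) + 1 : ℝ) : AddCircle (n : ℝ)) := by
  funext i
  rcases eq_mk_or_eq_last hn i with ⟨k, hk, rfl⟩ | rfl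
  · rw [rotate_of_lt _ _ hk, add_zero]
  · rw [rotate_last hn]
    simp only [natCast_pred_add_one hn, coe_natCast_circle]

/-- The component of the standard configuration consists of the configurations in the same cyclic
order. These form the image of a connected set, and on the configuration space the order of
the points as seen from the last one is locally constant. -/
theorem confS₀_eq {n : ℕ} (hn : 1 ≤ n) :
    confS₀ n = {y | y ∈ confS n ∧ gaps hn y ∈ simplex (n - 1) 0 n} := by
  have hbase := natCast_add_one_mem_simplex n
  refine Subset.antisymm ?_ ?_
  · have hmem : (fun i : Fin n => ((((i : ℕ) : ℝ) + 1 : ℝ) : AddCircle (n : ℝ))) ∈ confS n := by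
      rw [← rotate_natCast_add_one hn]
      exact rotate_mem_confS hn hbase 0
    let C : Set (confS n) := {y | gaps hn y ∈ simplex (n - 1) 0 n}
    have hcont : Continuous fun y : confS n => gaps hn y :=
      continuousOn_iff_continuous_domRestrict.1 (continuousOn_gaps hn)
    have hC : C = {y : confS n | Monotone (gaps hn y)} := by
      ext y
      exact ⟨fun h => h.1.monotone, fun h =>
        ⟨h.strictMono_of_injective (gaps_injective hn y.2), fun i => gaps_mem_Ioo hn y.2 i⟩⟩
    have hclopen : IsClopen C := by
      refine ⟨?_, (isOpen_simplex _ _ _).preimage hcont⟩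
      rw [hC]
      exact isClosed_monotone.preimage hcont
    rw [confS₀, connectedComponentIn_eq_image hmem]
    rintro _ ⟨y, hy, rfl⟩
    refine ⟨y.2, hclopen.connectedComponent_subset ?_ hy⟩
    have hgaps := gaps_rotate hn hbase 0
    rw [rotate_natCast_add_one hn] at hgaps
    change gaps hn (fun i : Fin n => ((((i : ℕ) : ℝ) + 1 : ℝ) : AddCircle (n : ℝ))) ∈
      simplex (n - 1) 0 (n : ℝ)
    rwa [hgaps]
  · have hpre : IsPreconnected ((fun p : (Fin (n - 1) → ℝ) × AddCircle (n : ℝ) =>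
        rotate n p.1 p.2) '' (simplex (n - 1) 0 n ×ˢ univ)) :=
      ((convex_simplex _ _ _).isPreconnected.prod isPreconnected_univ).image _
        (continuous_rotate n).continuousOn
    rintro y ⟨-, hy⟩
    refine hpre.subset_connectedComponentIn ⟨(_, 0), ⟨hbase, mem_univ _⟩,
      rotate_natCast_add_one hn⟩ ?_ ⟨(gaps hn y, y ⟨n - 1, by omega⟩), ⟨hy, mem_univ _⟩,
        rotate_gaps hn y⟩
    rintro _ ⟨⟨x, θ⟩, ⟨hx, -⟩, rfl⟩
    exact rotate_mem_confS hn hx θ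

theorem rotate_mem_confS₀ {n : ℕ} (hn : 1 ≤ n) {x : Fin (n - 1) → ℝ}
    (hx : x ∈ simplex (n - 1) 0 n) (θ : AddCircle (n : ℝ)) : rotate n x θ ∈ confS₀ n := by
  rw [confS₀_eq hn]
  exact ⟨rotate_mem_confS hn hx θ, by rwa [gaps_rotate hn hx]⟩

/-- The homeomorphism `Θ` which rotates the configuration `(x₁, …, x_{n-1}, 0)` by `θ`. Its inverse
reads off the angle of the last point and the positions of the others relative to it. -/
noncomputable def rotateHomeomorph {n : ℕ} (hn : 1 ≤ n) :
    simplex (n - 1) 0 (n : ℝ) × AddCircle (n : ℝ) ≃ₜ confS₀ n where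
  toFun p := ⟨rotate n p.1 p.2, rotate_mem_confS₀ hn p.1.2 p.2⟩
  invFun y := (⟨gaps hn y, ((confS₀_eq hn).subset y.2).2⟩, y.1 ⟨n - 1, by omega⟩)
  left_inv p := Prod.ext (Subtype.ext (gaps_rotate hn p.1.2 p.2)) (rotate_last hn _ _)
  right_inv y := Subtype.ext (rotate_gaps hn y.1)
  continuous_toFun := Continuous.subtype_mk ((continuous_rotate n).comp
    ((continuous_subtype_val.comp continuous_fst).prodMk continuous_snd)) _
  continuous_invFun := by
    refine (Continuous.subtype_mk ?_ _).prodMk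
      ((continuous_apply _).comp continuous_subtype_val)
    exact (continuousOn_gaps hn).comp_continuous continuous_subtype_val
      fun y => ((confS₀_eq hn).subset y.2).1

/-! ### Evaluation and its section on the circle -/

theorem evalS_eq_rotate {n : ℕ} (hn : 1 ≤ n) {h : diffS n} {F : ℝ → ℝ}
    (hF : IsLift n h.1 F) (h0 : F n = F 0 + n) :
    evalS n h = rotate n (fun i => F ((i : ℕ) + 1) - F 0) (F 0 : AddCircle (n : ℝ)) := by
  funext i
  rw [evalS, hF]
  rcases eq_mk_or_eq_last hn i with ⟨k, hk, rfl⟩ | rfl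
  · rw [rotate_of_lt _ _ hk, ← AddCircle.coe_add, sub_add_cancel]
  · rw [rotate_last hn]
    simp only [natCast_pred_add_one hn, h0, AddCircle.coe_add_period]

theorem evalS_mem_confS₀ {n : ℕ} (hn : 1 ≤ n) (h : diffS n) : evalS n h ∈ confS₀ n := by
  obtain ⟨⟨F, cF, mF, lF⟩, -⟩ := h.2
  have h0 : F n = F 0 + n := by
    simpa using lF.add_period hn cF.continuous 0
  rw [evalS_eq_rotate hn lF h0]
  refine rotate_mem_confS₀ hn ⟨fun i j hij => ?_, fun i => ⟨?_, ?_⟩⟩ _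
  · have : ((i : ℕ) : ℝ) < (j : ℕ) := by exact_mod_cast hij
    exact sub_lt_sub_right (mF (by linarith)) _
  · exact sub_pos.2 (mF (by positivity))
  · rw [sub_lt_iff_lt_add', ← h0]
    have : (i : ℕ) + 1 < n := by omega
    exact mF (by exact_mod_cast this)

theorem evalS_eq_iff {n : ℕ} (g h : diffS n) :
    evalS n g = evalS n h ↔ g⁻¹ * h ∈ diffSfe n := by
  have hmem : g⁻¹ * h ∈ diffSfe n ↔ ∀ k : ℕ, 1 ≤ k → k ≤ n →
      h.1 ((k : ℝ) : AddCircle (n : ℝ)) = g.1 ((k : ℝ) : AddCircle (n : ℝ)) := by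
    refine forall_congr' fun k => forall_congr' fun _ => forall_congr' fun _ => ?_
    change g.1.symm (h.1 _) = _ ↔ _
    rw [Equiv.symm_apply_eq]
  rw [hmem]
  refine ⟨fun he k hk hkn => ?_, fun he => funext fun i => ?_⟩
  · have := congrFun he ⟨k - 1, by omega⟩
    simpa only [evalS, natCast_pred_add_one hk] using this.symm
  · have := he (i + 1) (by omega) (by omega)
    push_cast at this
    exact this.symm

theorem stretch_of_natCast_le {n : ℕ} (hn : 1 ≤ n) {x : Fin (n - 1) → ℝ}
    (hx : x ∈ simplex (n - 1) 0 n) (t : ℝ) (ht : (n : ℝ) ≤ t) : stretch (n - 1) x t = t := by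
  rw [← natCast_pred_add_one hn] at hx ht
  exact stretch_of_ge hx ht

theorem wrap_stretch_contDiff {n : ℕ} (hn : 1 ≤ n) {x : Fin (n - 1) → ℝ}
    (hx : x ∈ simplex (n - 1) 0 n) : ContDiff ℝ ∞ (wrap n (stretch (n - 1) x)) :=
  wrap_contDiff hn (stretch_contDiff _ _) (fun _ => stretch_of_le _ _)
    (stretch_of_natCast_le hn hx)

theorem exists_diffS_eq_stretch {n : ℕ} (hn : 1 ≤ n)
    (p : simplex (n - 1) 0 (n : ℝ) × AddCircle (n : ℝ)) :
    ∃ h : diffS n, ∀ t : ℝ, h.1 (t : AddCircle (n : ℝ)) =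
      (wrap n (stretch (n - 1) p.1) t : AddCircle (n : ℝ)) + p.2 := by
  obtain ⟨x, θ⟩ := p
  induction θ using QuotientAddGroup.induction_on with
  | H s =>
    obtain ⟨h, hh⟩ := exists_mem_diffS hn
      (F := fun t => wrap n (stretch (n - 1) x) t + s)
      ((wrap_stretch_contDiff hn x.2).add contDiff_const)
      (fun t => by
        rw [deriv_add_const]
        exact deriv_wrap_pos hn (stretch_contDiff _ _) (deriv_stretch_pos _ _)
          (fun _ => stretch_of_le _ _) (stretch_of_natCast_le hn x.2) t)
      (fun t => by
        rw [wrap_add_period hn]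
        ring)
    exact ⟨h, hh⟩

theorem evalS_of_eq_stretch {n : ℕ} (hn : 1 ≤ n)
    (p : simplex (n - 1) 0 (n : ℝ) × AddCircle (n : ℝ)) {h : diffS n}
    (hh : ∀ t : ℝ, h.1 (t : AddCircle (n : ℝ)) =
      (wrap n (stretch (n - 1) p.1) t : AddCircle (n : ℝ)) + p.2) :
    evalS n h = rotate n p.1 p.2 := by
  have hx : p.1.1 ∈ simplex (n - 1) 0 (((n - 1 : ℕ) : ℝ) + 1) := by
    rw [natCast_pred_add_one hn]
    exact p.1.2
  funext i
  have hi : (i : ℕ) + 1 ≤ n := i.2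
  have hi' : ((i : ℕ) : ℝ) + 1 ∈ Icc (0 : ℝ) n := ⟨by positivity, by exact_mod_cast hi⟩
  have hnode := stretch_natCast hx (k := i + 1) (by omega)
  push_cast at hnode
  rw [evalS, hh, wrap_of_mem_Icc hn (fun _ => stretch_of_le _ _)
    (stretch_of_natCast_le hn p.1.2) hi', hnode]
  rcases eq_mk_or_eq_last hn i with ⟨k, hk, rfl⟩ | rfl
  · rw [rotate_of_lt _ _ hk, node_succ_of_lt _ hk]
  · rw [rotate_last hn, node_last, natCast_pred_add_one hn, coe_natCast_circle, zero_add]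

/-- Continuity is checked after the angle has been lifted to the line, where the lifts of the
diffeomorphisms depend continuously on all parameters. -/
theorem continuous_of_eq_wrap_stretch {n : ℕ} (hn : 1 ≤ n)
    {σ : simplex (n - 1) 0 (n : ℝ) × AddCircle (n : ℝ) → diffS n}
    (hσ : ∀ p, ∀ t : ℝ, (σ p).1 (t : AddCircle (n : ℝ)) =
      (wrap n (stretch (n - 1) p.1) t : AddCircle (n : ℝ)) + p.2) (r : ℕ∞) :
    Continuous[inferInstance, whitneyS n r] σ := by
  let := whitneyS n r
  have hq : IsOpenQuotientMap
      (Prod.map id ((↑) : ℝ → AddCircle (n : ℝ)) :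
        simplex (n - 1) 0 (n : ℝ) × ℝ → simplex (n - 1) 0 (n : ℝ) × AddCircle (n : ℝ)) :=
    IsOpenQuotientMap.id.prodMap QuotientAddGroup.isOpenQuotientMap_mk
  refine hq.isQuotientMap.continuous_iff.2 ?_
  have hsmooth (p : simplex (n - 1) 0 (n : ℝ) × ℝ) :
      ContDiff ℝ ∞ fun t => wrap n (stretch (n - 1) p.1) t + p.2 :=
    (wrap_stretch_contDiff hn p.1.2).add contDiff_const
  refine continuous_whitneyS_of_lift hn hsmooth (fun p t => ?_) (fun i => ?_) r
  · rw [Function.comp_apply, hσ, AddCircle.coe_add]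
    rfl
  · have hx (p : (simplex (n - 1) 0 (n : ℝ) × ℝ) × ℝ) (u : ℝ) :
        (p.1.1.1, u) ∈ simplex (n - 1) 0 (((n - 1 : ℕ) : ℝ) + 1) ×ˢ (univ : Set ℝ) := by
      rw [natCast_pred_add_one hn]
      exact mk_mem_prod p.1.1.2 (mem_univ _)
    have hfst : Continuous fun p : (simplex (n - 1) 0 (n : ℝ) × ℝ) × ℝ => p.1.1.1 := by fun_prop
    have h1 := (continuousOn_iteratedDeriv_stretch (n - 1) i).comp_continuous
      (hfst.prodMk continuous_snd) fun p => hx p p.2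
    have h2 := (continuousOn_iteratedDeriv_stretch (n - 1) i).comp_continuous
      (hfst.prodMk (continuous_snd.add (continuous_const (y := (n : ℝ))))) fun p => hx p (p.2 + n)
    have h3 : Continuous fun p : (simplex (n - 1) 0 (n : ℝ) × ℝ) × ℝ =>
        iteratedDeriv i (id : ℝ → ℝ) (p.2 + n) :=
      ((contDiff_id (n := i)).continuous_iteratedDeriv i le_rfl).comp (by fun_prop)
    have h4 : Continuous fun p : (simplex (n - 1) 0 (n : ℝ) × ℝ) × ℝ =>
        if i = 0 then p.1.2 else 0 := by
      split_ifs <;> fun_prop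
    refine (((h1.add h2).sub h3).add h4).continuousOn.congr fun p hp => ?_
    simp only [iteratedDeriv_add_const_apply]
    rw [iteratedDeriv_wrap hn (stretch_contDiff _ _) (fun _ => stretch_of_le _ _)
      (stretch_of_natCast_le hn p.1.1.2) i hp.2]
    rfl

/-- The statement for the circle: evaluation is a homeomorphism from the coset space onto the
component of the configuration space, the latter is a product of the circle and a simplex, and
the rotated stretching maps form a continuous section. -/
theorem circle_case {n : ℕ} (hn : 1 ≤ n) :
    (∃ Φ : (diffS n ⧸ diffSfe n) → confS₀ n,
        (∀ h : diffS n, (Φ (QuotientGroup.mk h) : Fin n → AddCircle (n : ℝ)) = evalS n h) ∧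
        ∀ r : ℕ∞, @IsHomeomorph _ _ (whitneySQuot n r) inferInstance Φ) ∧
    (∃ (Θ : simplex (n - 1) 0 (n : ℝ) × AddCircle (n : ℝ) ≃ₜ confS₀ n)
        (σ : confS₀ n → diffS n),
        (∀ x θ, (Θ (x, θ) : Fin n → AddCircle (n : ℝ)) = rotate n x θ) ∧
        (∀ y, evalS n (σ y) = y) ∧
        (∀ x θ, ∀ t ∈ Icc (0 : ℝ) n,
          (σ (Θ (x, θ))).1 (t : AddCircle (n : ℝ)) =
            (stretch (n - 1) x t : AddCircle (n : ℝ)) + θ) ∧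
        ∀ r : ℕ∞, Continuous[inferInstance, whitneyS n r] σ) ∧
    (∃ Ψ : (diffS n ⧸ diffSfe n) → AddCircle (n : ℝ) × (Fin (n - 1) → ℝ),
        ∀ r : ℕ∞, @IsHomeomorph _ _ (whitneySQuot n r) inferInstance Ψ) := by
  choose τ hτ using exists_diffS_eq_stretch hn
  let Θ := rotateHomeomorph hn
  let σ : confS₀ n → diffS n := τ ∘ Θ.symm
  have hs : ∀ y, evalS n (σ y) = y := fun y => by
    rw [show σ y = τ (Θ.symm y) from rfl, evalS_of_eq_stretch hn _ (hτ _)]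
    exact congrArg Subtype.val (Θ.apply_symm_apply y)
  have hcont (r : ℕ∞) : Continuous[inferInstance, whitneyS n r] σ := by
    let := whitneyS n r
    exact (continuous_of_eq_wrap_stretch hn hτ r).comp Θ.symm.continuous
  obtain ⟨Φ, hΦ, hhom⟩ := exists_isHomeomorph_quotient (whitneyS n)
    (ev := fun h => (⟨evalS n h, evalS_mem_confS₀ hn h⟩ : confS₀ n))
    (σ := σ) (H := diffSfe n) (fun g h => Subtype.mk_eq_mk.trans (evalS_eq_iff g h))
    (fun r => by
      let := whitneyS n r
      exact Continuous.subtype_mk (continuous_pi fun i => continuous_eval_whitneyS n r _) _)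
    hcont (fun y => Subtype.ext (hs y))
  obtain ⟨e⟩ := nonempty_simplex_homeomorph ⟨_, natCast_add_one_mem_simplex n⟩
  refine ⟨⟨Φ, fun h => by rw [hΦ], hhom⟩, ⟨Θ, σ, fun x θ => rfl, hs, fun x θ t ht => ?_, hcont⟩,
    exists_isHomeomorph_comp hhom (Θ.symm.trans ((Homeomorph.prodComm _ _).trans
      ((Homeomorph.refl _).prodCongr e)))⟩
  rw [show σ (Θ (x, θ)) = τ (x, θ) from congrArg τ (Θ.symm_apply_apply _), hτ,
    wrap_of_mem_Icc hn (fun _ => stretch_of_le _ _) (stretch_of_natCast_le hn x.2) ht]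

end WhitneyDiff

theorem mainTheorem5 :
    (∀ n : ℕ, 2 ≤ n →
      (∃ Φ : (WhitneyDiff.diffRf n ⧸ WhitneyDiff.diffRfe n) →
            WhitneyDiff.simplex (n - 2) 1 (n : ℝ),
          (∀ h : WhitneyDiff.diffRf n,
            (Φ (QuotientGroup.mk h) : Fin (n - 2) → ℝ) = WhitneyDiff.evalR n h) ∧
          ∀ r : ℕ∞, @IsHomeomorph _ _ (WhitneyDiff.whitneyRQuot n r) inferInstance Φ) ∧
      (∃ σ : WhitneyDiff.simplex (n - 2) 1 (n : ℝ) → WhitneyDiff.diffRf n,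
          (∀ x, WhitneyDiff.evalR n (σ x) = x) ∧
          (∀ x, ∀ t : ℝ,
            (σ x).1.1 t = WhitneyDiff.stretch n (WhitneyDiff.addEnds n x) t) ∧
          ∀ r : ℕ∞, Continuous[inferInstance, WhitneyDiff.whitneyRf n r] σ) ∧
      (∃ Ψ : (WhitneyDiff.diffRf n ⧸ WhitneyDiff.diffRfe n) → (Fin (n - 2) → ℝ),
          ∀ r : ℕ∞, @IsHomeomorph _ _ (WhitneyDiff.whitneyRQuot n r) inferInstance Ψ)) ∧
    (∀ n : ℕ, 1 ≤ n →
      (∃ Φ : (WhitneyDiff.diffS n ⧸ WhitneyDiff.diffSfe n) → WhitneyDiff.confS₀ n,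
          (∀ h : WhitneyDiff.diffS n,
            (Φ (QuotientGroup.mk h) : Fin n → AddCircle (n : ℝ)) = WhitneyDiff.evalS n h) ∧
          ∀ r : ℕ∞, @IsHomeomorph _ _ (WhitneyDiff.whitneySQuot n r) inferInstance Φ) ∧
      (∃ (Θ : WhitneyDiff.simplex (n - 1) 0 (n : ℝ) × AddCircle (n : ℝ) ≃ₜ WhitneyDiff.confS₀ n)
          (σ : WhitneyDiff.confS₀ n → WhitneyDiff.diffS n),
          (∀ x θ, (Θ (x, θ) : Fin n → AddCircle (n : ℝ)) = WhitneyDiff.rotate n x θ) ∧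
          (∀ y, WhitneyDiff.evalS n (σ y) = y) ∧
          (∀ x θ, ∀ t ∈ Set.Icc (0 : ℝ) n,
            (σ (Θ (x, θ))).1 (t : AddCircle (n : ℝ)) =
              (WhitneyDiff.stretch (n - 1) x t : AddCircle (n : ℝ)) + θ) ∧
          ∀ r : ℕ∞, Continuous[inferInstance, WhitneyDiff.whitneyS n r] σ) ∧
      (∃ Ψ : (WhitneyDiff.diffS n ⧸ WhitneyDiff.diffSfe n) →
            AddCircle (n : ℝ) × (Fin (n - 1) → ℝ),
          ∀ r : ℕ∞, @IsHomeomorph _ _ (WhitneyDiff.whitneySQuot n r) inferInstance Ψ)) :=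
  ⟨fun _ hn => WhitneyDiff.line_case hn, fun _ hn => WhitneyDiff.circle_case hn⟩
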